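/- **Setting.** Let $S,A$ be finite nonempty sets, $R\subset[0,\infty)$ a finite set of rewards, $\gamma\in(0,1)$, $\delta>0$. For each $(s,a)\in S\times A$ let $\nu_{s,a}$ be a probability distribution on $R$ (reward) and $p_{s,a}$ a probability distribution on $S$ (next state). For a distribution $\mu$ let $\mathcal U_\delta(\mu)=\{\rho: D_{\mathrm{KL}}(\rho\|\mu)\le\delta\}$. Let $v^*\in\mathbb R^S$ be the unique solution of the distributionally robust (DR) Bellman equation $$v^*(s)=\max_{a\in A}\ \inf_{\nu\in\mathcal U_\delta(\nu_{s,a}),\,p\in\mathcal U_\delta(p_{s,a})}\big(E_{r\sim\nu}[r]+\gamma E_{s'\sim p}[v^*(s')]\big),$$ and let $$q^*(s,a)=\inf_{\nu\in\mathcal U_\delta(\nu_{s,a}),\,p\in\mathcal U_\delta(p_{s,a})}\big(E_{r\sim\nu}[r]+\gamma E_{s'\sim p}[v^*(s')]\big).$$ Let $p_\wedge$ be the minimal support probability, i.e. the smallest of all the positive numbers among $\nu_{s,a}(r)$ and $p_{s,a}(s')$ $(s,s'\in S,\ a\in A,\ r\in R)$, and let $d=|S||A|\max(|S|,|R|)$.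 **DR Q-learning** with $k_0\ge1$ iterations and batch size $n_0\ge1$. Start from $q_1\equiv0$. For $k=1,\dots,k_0$ draw a fresh batch: for each $(s,a)$, rewards $r_1,\dots,r_{n_0}$ i.i.d. from $\nu_{s,a}$ and next states $s'_1,\dots,s'_{n_0}$ i.i.d. from $p_{s,a}$, the sample indices within a batch and the batches being independent. Put $$\mathbf T_{k+1}(q)(s,a)=\sup_{\alpha\ge0}\Big\{-\alpha\log\tfrac1{n_0}\sum_{i=1}^{n_0}e^{-r_i/\alpha}-\alpha\delta\Big\}+\gamma\sup_{\beta\ge0}\Big\{-\beta\log\tfrac1{n_0}\sum_{i=1}^{n_0}e^{-\max_{b}q(s'_i,b)/\beta}-\beta\delta\Big\}$$ (at $\alpha=0$ or $\beta=0$ the expression is its limit, the minimum of $r_i$, respectively of $\max_b q(s_i',b)$, over $i$), and $$q_{k+1}=(1-\lambda_k)q_k+\lambda_k\mathbf T_{k+1}(q_k),\qquad \lambda_k=\frac1{1+(1-\gamma)k}.$$ **Proposition.** There is an absolute constant $c'>0$ such that, for all data as above with $R\subset[0,1]$ and $\delta<-\log\!\big(1-\tfrac1{48}p_\wedge\big)$,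 all $k_0,n_0\ge1$ and all $\eta\in(0,1)$, the output $q_{k_0+1}$ of DR Q-learning satisfies, with probability at least $1-\eta$, $$\|q_{k_0+1}-q^*\|_\infty\le c'\left(\frac1{(1-\gamma)^3k_0}+\frac1{p_\wedge^3(1-\gamma)^2n_0}+\frac1{p_\wedge(1-\gamma)^{5/2}\sqrt{n_0k_0}}\right)\Big(\log\frac{4dk_0}{\eta}\Big)^2 .$$ -/

import Mathlib

open MeasureTheory ProbabilityTheory

universe u v w

/-- A tabular Markov decision process with finitely many, nonnegative rewards, a discount factor
`γ ∈ (0,1)`, and an adversarial power `δ > 0` (the radius of the KL uncertainty sets).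
`rewardLaw s a` and `transition s a` are the nominal reward and next-state distributions. -/
structure RobustMDP (S : Type u) (A : Type v) where
  rewards : Finset ℝ
  rewards_nonneg : ∀ r ∈ rewards, 0 ≤ r
  rewardLaw : S → A → PMF rewards
  transition : S → A → PMF S
  γ : ℝ
  γ_pos : 0 < γ
  γ_lt_one : γ < 1
  δ : ℝ
  δ_pos : 0 < δ

/-- The KL uncertainty set `{ρ : D_KL(ρ ‖ μ) ≤ δ}` of probability distributions around `μ`. -/
def klBall {U : Type*} [MeasurableSpace U] (μ : PMF U) (δ : ℝ) : Set (PMF U) :=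
  {ρ | InformationTheory.klDiv ρ.toMeasure μ.toMeasure ≤ ENNReal.ofReal δ}

/-- The expectation of `f` under a distribution on a finite set. -/
noncomputable def pmfMean {U : Type*} [Fintype U] (ρ : PMF U) (f : U → ℝ) : ℝ :=
  ∑ u, (ρ u).toReal * f u

namespace RobustMDP

variable {S : Type u} {A : Type v} [Fintype S] [MeasurableSpace S]

/-- The worst-case one-step return
`inf { E_{r ∼ ν}[r] + γ E_{s' ∼ p}[v(s')] : ν ∈ R_{s,a}(δ), p ∈ P_{s,a}(δ) }`. -/
noncomputable def robustReturn (M : RobustMDP S A) (v : S → ℝ) (s : S) (a : A) : ℝ :=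
  ⨅ x : klBall (M.rewardLaw s a) M.δ × klBall (M.transition s a) M.δ,
    (pmfMean (x.1 : PMF M.rewards) (fun r => (r : ℝ)) + M.γ * pmfMean (x.2 : PMF S) v)

/-- The distributionally robust Bellman operator on value functions. -/
noncomputable def bellman (M : RobustMDP S A) (v : S → ℝ) : S → ℝ :=
  fun s => ⨆ a, M.robustReturn v s a

end RobustMDP

section FixedPoint

theorem abs_pmfMean_le {U : Type*} [Fintype U] (ρ : PMF U) (f : U → ℝ) (C : ℝ)
    (hf : ∀ u, |f u| ≤ C) : |pmfMean ρ f| ≤ C := by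
  have h1 : ∑ u, (ρ u).toReal = 1 := by
    rw [← ENNReal.toReal_sum (fun u _ => ρ.apply_ne_top u), ← tsum_fintype (L := .unconditional U),
      ρ.tsum_coe, ENNReal.toReal_one]
  calc |pmfMean ρ f| ≤ ∑ u, |(ρ u).toReal * f u| := Finset.abs_sum_le_sum_abs _ _
    _ ≤ ∑ u, (ρ u).toReal * C := by
        refine Finset.sum_le_sum fun u _ => ?_
        rw [abs_mul, abs_of_nonneg ENNReal.toReal_nonneg]
        exact mul_le_mul_of_nonneg_left (hf u) ENNReal.toReal_nonneg
    _ = C := by rw [← Finset.sum_mul, h1, one_mul]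

theorem pmfMean_sub {U : Type*} [Fintype U] (ρ : PMF U) (f g : U → ℝ) :
    pmfMean ρ f - pmfMean ρ g = pmfMean ρ (f - g) := by
  simp [pmfMean, mul_sub]

theorem self_mem_klBall {U : Type*} [MeasurableSpace U] (μ : PMF U) (δ : ℝ) :
    μ ∈ klBall μ δ := by
  simp [klBall, InformationTheory.klDiv_self]

namespace RobustMDP

variable {S : Type u} {A : Type v} [Fintype S] [MeasurableSpace S]

theorem robustReturn_bddBelow (M : RobustMDP S A) (v : S → ℝ) (s : S) (a : A) :
    BddBelow (Set.range fun x : klBall (M.rewardLaw s a) M.δ × klBall (M.transition s a) M.δ =>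
      pmfMean (x.1 : PMF M.rewards) (fun r => (r : ℝ)) + M.γ * pmfMean (x.2 : PMF S) v) := by
  refine ⟨-‖fun r : M.rewards => (r : ℝ)‖ - M.γ * ‖v‖, ?_⟩
  rintro _ ⟨x, rfl⟩
  have h1 := abs_le.1 (abs_pmfMean_le (x.1 : PMF M.rewards) (fun r => (r : ℝ)) _
    (fun r => norm_le_pi_norm (fun r : M.rewards => (r : ℝ)) r))
  have h2 := abs_le.1 (abs_pmfMean_le (x.2 : PMF S) v _ (fun r => norm_le_pi_norm v r))
  have h3 := mul_le_mul_of_nonneg_left h2.1 M.γ_pos.le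
  simp only
  linarith [h1.1]

theorem robustReturn_le (M : RobustMDP S A) (v w : S → ℝ) (s : S) (a : A) :
    M.robustReturn v s a ≤ M.robustReturn w s a + M.γ * ‖v - w‖ := by
  have : Nonempty (klBall (M.rewardLaw s a) M.δ × klBall (M.transition s a) M.δ) :=
    ⟨⟨⟨_, self_mem_klBall _ _⟩, ⟨_, self_mem_klBall _ _⟩⟩⟩
  rw [← sub_le_iff_le_add]
  refine le_ciInf fun x => ?_
  have h := ciInf_le (M.robustReturn_bddBelow v s a) x
  have h2 := abs_le.1 (abs_pmfMean_le (x.2 : PMF S) (v - w) ‖v - w‖ (fun r => norm_le_pi_norm (v - w) r))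
  rw [← pmfMean_sub] at h2
  have h3 := mul_le_mul_of_nonneg_left h2.2 M.γ_pos.le
  unfold robustReturn
  linarith

theorem bellman_le [Finite A] [Nonempty A] (M : RobustMDP S A) (v w : S → ℝ) (s : S) :
    M.bellman v s ≤ M.bellman w s + M.γ * ‖v - w‖ := by
  refine ciSup_le fun a => (M.robustReturn_le v w s a).trans ?_
  gcongr
  exact le_ciSup (f := fun a => M.robustReturn w s a) (Set.finite_range _).bddAbove a

theorem bellman_contracting [Finite A] [Nonempty A] (M : RobustMDP S A) :
    ContractingWith ⟨M.γ, M.γ_pos.le⟩ M.bellman := by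
  refine ⟨by exact_mod_cast M.γ_lt_one, LipschitzWith.of_dist_le_mul fun v w => ?_⟩
  rw [dist_eq_norm, dist_eq_norm]
  refine (pi_norm_le_iff_of_nonneg (mul_nonneg M.γ_pos.le (norm_nonneg _))).2 fun s => ?_
  have h1 := M.bellman_le v w s
  have h2 := M.bellman_le w v s
  rw [norm_sub_rev] at h2
  rw [Pi.sub_apply, Real.norm_eq_abs, abs_le]
  change -(M.γ * ‖v - w‖) ≤ _ ∧ _ ≤ M.γ * ‖v - w‖
  constructor <;> linarith

theorem existsUnique_bellman_eq [Finite A] [Nonempty A] (M : RobustMDP S A) :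
    ∃! v : S → ℝ, M.bellman v = v :=
  ⟨_, M.bellman_contracting.fixedPoint_isFixedPt,
    fun _ hv => M.bellman_contracting.fixedPoint_unique hv⟩

end RobustMDP

end FixedPoint

namespace RobustMDP

variable {S : Type u} {A : Type v} [Fintype S] [MeasurableSpace S]

/-- The optimal robust value function: the unique solution of the robust Bellman equation. -/
noncomputable def optValue [Finite A] [Nonempty A] (M : RobustMDP S A) : S → ℝ :=
  M.existsUnique_bellman_eq.choose

/-- The optimal robust `q`-function `q*`. -/
noncomputable def optQ [Finite A] [Nonempty A] (M : RobustMDP S A) : S → A → ℝ :=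
  fun s a => M.robustReturn M.optValue s a

end RobustMDP

/-- The KL dual objective of the empirical measure of the samples `x 0, …, x (n-1)`,
`-α log((1/n) ∑ e^{-f(x i)/α}) - α δ`, extended to `α = 0` by its limit as `α ↓ 0`, the minimum of
`f` over the samples. -/
noncomputable def empDualObj {U : Type*} {n : ℕ} (x : Fin n → U) (f : U → ℝ) (δ α : ℝ) : ℝ :=
  if α = 0 then ⨅ i, f (x i)
  else -α * Real.log ((∑ i, Real.exp (-f (x i) / α)) / n) - α * δ

/-- The supremum of the empirical KL dual objective over `α ≥ 0`. -/
noncomputable def empDual {U : Type*} {n : ℕ} (x : Fin n → U) (f : U → ℝ) (δ : ℝ) : ℝ :=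
  ⨆ α : Set.Ici (0 : ℝ), empDualObj x f δ α

namespace RobustMDP

variable {S : Type u} {A : Type v}

/-- The empirical robust Bellman operator `T(q)(s,a)` built from a batch of `n` samples; sample `i`
consists, for each `(s,a)`, of a reward `(x i s a).1` and a next state `(x i s a).2`. -/
noncomputable def empBellman (M : RobustMDP S A) {n : ℕ} (x : Fin n → S → A → M.rewards × S)
    (q : S → A → ℝ) : S → A → ℝ :=
  fun s a =>
    empDual (fun i => (x i s a).1) (fun r => (r : ℝ)) M.δ +
      M.γ * empDual (fun i => (x i s a).2) (fun s' => ⨆ b, q s' b) M.δ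

/-- The stepsize `λ_k = 1 / (1 + (1 - γ) k)`. -/
noncomputable def stepsize (M : RobustMDP S A) (k : ℕ) : ℝ :=
  1 / (1 + (1 - M.γ) * k)

/-- Distributionally robust Q-learning run on the batches `x 1, x 2, …`. `M.drQ x k` is the
`q`-function after `k` updates, which is called `q_{k+1}`: it starts from `q_1 = 0`, and the `k`-th
update `q_{k+1} = (1 - λ_k) q_k + λ_k T_{k+1}(q_k)` uses the `k`-th batch `x k`. -/
noncomputable def drQ (M : RobustMDP S A) {n : ℕ} (x : ℕ → Fin n → S → A → M.rewards × S) :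
    ℕ → S → A → ℝ
  | 0 => 0
  | k + 1 => (1 - M.stepsize (k + 1)) • drQ M x k +
      M.stepsize (k + 1) • M.empBellman (x (k + 1)) (drQ M x k)

/-- Samples drawn from the simulator: independent over the batch `k` and the index `i` in the batch,
with the nominal reward and next-state laws at every `(s,a)`. No restriction is put on the joint law
within one sample, so this includes the case where all the draws are mutually independent. -/
structure IsSampling (M : RobustMDP S A) [MeasurableSpace S] {Ω : Type w} [MeasurableSpace Ω]
    (P : Measure Ω) {n : ℕ} (X : ℕ → Fin n → Ω → S → A → M.rewards × S) : Prop where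
  measurable : ∀ k i, Measurable (X k i)
  indep : iIndepFun (fun (j : ℕ × Fin n) => X j.1 j.2) P
  reward_law : ∀ k i s a, P.map (fun ω => (X k i ω s a).1) = (M.rewardLaw s a).toMeasure
  transition_law : ∀ k i s a, P.map (fun ω => (X k i ω s a).2) = (M.transition s a).toMeasure

/-- The minimal support probability `p_∧`. -/
noncomputable def minSupportProb (M : RobustMDP S A) : ℝ :=
  ⨅ x : S × A, min
    (⨅ r : (M.rewardLaw x.1 x.2).support, (M.rewardLaw x.1 x.2 r).toReal)
    (⨅ s' : (M.transition x.1 x.2).support, (M.transition x.1 x.2 s').toReal)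

/-- The size parameter `d = |S| |A| (|S| ∨ |R|)`. -/
def size [Fintype S] [Fintype A] (M : RobustMDP S A) : ℕ :=
  Fintype.card S * Fintype.card A * max (Fintype.card S) M.rewards.card

end RobustMDP

/-! Write `W j` for the error `T_j(q*) - q*` of batch `j` (`bellmanNoise`). Since `q*` is
deterministic, these errors are independent across batches, unlike those made at the iterates. Let
`P_k` be their average under the stepsize recursion (`stepAvg`). The remainder `Δ_k = q_k - q* -
P_k` obeys `Δ_{k+1} = (1 - λ) Δ_k + λ (T(q_k) - T(q*))`, and every empirical operator is a
`γ`-contraction, so `|Δ_{k+1}| ≤ (1 - (1 - γ) λ) |Δ_k| + λ |P_k|` in sup norm. The stepsizes satisfy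
`(1 - (1 - γ) λ_{k+1}) λ_k = λ_{k+1}`, so this telescopes after division by `λ_{k+1}`
(`abs_drQ_sub_le`), and only bounds on the `P_k` are needed.

Averaging multiplies the standard deviation of the noise by `√λ_k` (Bernstein,
`measureReal_stepAvg_le`) but does not reduce its bias. The bias must therefore be of order `1/n`,
not `1/√n`, which requires a second-order expansion of the empirical KL dual value
(`exists_isLeast_empDual_expansion`). For `δ ≤ p/32`, where `p` is the minimal support probability,
and for a payoff rescaled to span `[0,1]`, the dual maximiser `t = 1/α` lies in `(0,1]` for the true
law and for every nearby empirical law (`exists_tiltEntropy_eq`). There the influence function is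
bounded and Lipschitz in `t`, and the dual objective has a quadratic drop of modulus `p` at its
maximiser (`klDual_le_sub`). Moving the maximiser thus has only a second-order effect: with relative
deviation `ξ` of the frequencies, the error is a linear statistic of mean zero plus `O(ξ²/p)`. Since
`E ξ² ≤ 1/(n p²)`, the noise has variance `O(1/(n p²))` and bias `O(1/(n p³))`, up to factors of
`1/(1 - γ)`.

Summing the resulting bounds over `k` (`accumulated_error_le`), with a union bound over states,
actions and times, gives the three terms. -/

/-! ### Elementary inequalities for entropy and exponentials. -/

section Entropy

theorem sq_sqrt_sub_one_le {x : ℝ} (hx : 0 < x) : (√x - 1) ^ 2 ≤ x * Real.log x - x + 1 := by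
  have h0 : 0 < √x := Real.sqrt_pos.2 hx
  have h1 := Real.one_sub_inv_le_log_of_pos h0
  have h2 : √x ^ 2 = x := Real.sq_sqrt hx.le
  have h3 : Real.log x = 2 * Real.log √x := by
    rw [← h2, Real.log_pow, Real.sqrt_sq h0.le]; norm_num
  have h4 : √x ^ 2 * (1 - (√x)⁻¹) = √x ^ 2 - √x := by field_simp
  have h5 := mul_le_mul_of_nonneg_left h1 (sq_nonneg √x)
  rw [h4] at h5
  rw [h3]
  nlinarith

/-- Two numbers in ratio `r = e^{s/2}` cannot both be near one: Cauchy–Schwarz applied to `r - 1 =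
(rc - 1) - r(c - 1)`, with `r - 1 ≥ s/2` and `r² + 1 ≤ e + 1 ≤ 4`. -/
theorem sq_div_le_of_ratio {c s : ℝ} (hs0 : 0 ≤ s) (hs1 : s ≤ 1) :
    s ^ 2 / 16 ≤ (Real.exp (s / 2) * c - 1) ^ 2 + (c - 1) ^ 2 := by
  set r := Real.exp (s / 2)
  have h1 : 1 + s / 2 ≤ r := by linarith [Real.add_one_le_exp (s / 2)]
  have h2 : r ^ 2 + 1 ≤ 4 := by
    have : r ^ 2 = Real.exp s := by rw [← Real.exp_nat_mul]; congr 1; push_cast; ring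
    have h3 : Real.exp s ≤ Real.exp 1 := Real.exp_le_exp.2 hs1
    linarith [Real.exp_one_lt_d9]
  have h3 : (r - 1) ^ 2 ≤ (r ^ 2 + 1) * ((r * c - 1) ^ 2 + (c - 1) ^ 2) := by
    nlinarith [sq_nonneg ((r ^ 2 + 1) * c - (r + 1))]
  have h4 : 0 ≤ (r * c - 1) ^ 2 + (c - 1) ^ 2 := by positivity
  nlinarith

variable {U : Type*} [Fintype U]

/-- Equal total masses allow `x log x` to be replaced by the nonnegative `x log x - x + 1`; then all
terms except those at `a` and `b` can be dropped. -/
theorem sq_div_le_entropy_aux {m x : U → ℝ} (hm : ∀ u, 0 ≤ m u) (hx : ∀ u, 0 < x u)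
    (hmx : ∑ u, m u * x u = ∑ u, m u) {a b : U} (hab : a ≠ b) {p s : ℝ} (hp : 0 ≤ p)
    (ha : p ≤ m a) (hb : p ≤ m b) (hs0 : 0 ≤ s) (hs1 : s ≤ 1)
    (hs : Real.log (x a) - Real.log (x b) = s) :
    p * s ^ 2 / 16 ≤ ∑ u, m u * (x u * Real.log (x u)) := by
  classical
  have h1 : ∑ u, m u * (x u * Real.log (x u)) =
      ∑ u, m u * (x u * Real.log (x u) - x u + 1) := by
    simp only [mul_add, mul_sub, Finset.sum_add_distrib, Finset.sum_sub_distrib, hmx]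
    simp
  have h2 : m a * (√(x a) - 1) ^ 2 + m b * (√(x b) - 1) ^ 2 ≤
      ∑ u, m u * (x u * Real.log (x u) - x u + 1) := by
    calc _ ≤ m a * (x a * Real.log (x a) - x a + 1) + m b * (x b * Real.log (x b) - x b + 1) := by
          gcongr
          · exact hm a
          · exact sq_sqrt_sub_one_le (hx a)
          · exact hm b
          · exact sq_sqrt_sub_one_le (hx b)
      _ = ∑ u ∈ {a, b}, m u * (x u * Real.log (x u) - x u + 1) := by rw [Finset.sum_pair hab]
      _ ≤ _ := by
          refine Finset.sum_le_sum_of_subset_of_nonneg (Finset.subset_univ _) fun u _ _ => ?_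
          exact mul_nonneg (hm u) ((sq_nonneg _).trans (sq_sqrt_sub_one_le (hx u)))
  have h3 : √(x a) = Real.exp (s / 2) * √(x b) := by
    have : x a = Real.exp s * x b := by
      rw [← hs, Real.exp_sub, Real.exp_log (hx a), Real.exp_log (hx b)]
      field_simp [(hx b).ne']
    rw [this, Real.sqrt_mul (Real.exp_pos _).le, Real.exp_half]
  have h4 := sq_div_le_of_ratio (c := √(x b)) hs0 hs1
  rw [← h3] at h4
  rw [h1]
  refine le_trans ?_ h2
  have h5 := mul_le_mul_of_nonneg_left h4 hp
  nlinarith [mul_le_mul_of_nonneg_right ha (sq_nonneg (√(x a) - 1)),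
    mul_le_mul_of_nonneg_right hb (sq_nonneg (√(x b) - 1))]

/-- A lower bound for relative entropy in terms of the likelihood ratio at two points. -/
theorem sq_div_le_entropy {m x : U → ℝ} (hm : ∀ u, 0 ≤ m u) (hx : ∀ u, 0 < x u)
    (hmx : ∑ u, m u * x u = ∑ u, m u) {a b : U} (hab : a ≠ b) {p s : ℝ} (hp : 0 ≤ p)
    (ha : p ≤ m a) (hb : p ≤ m b) (hs1 : |s| ≤ 1)
    (hs : Real.log (x a) - Real.log (x b) = s) :
    p * s ^ 2 / 16 ≤ ∑ u, m u * (x u * Real.log (x u)) := by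
  rcases le_total 0 s with h | h
  · exact sq_div_le_entropy_aux hm hx hmx hab hp ha hb h (le_trans (le_abs_self _) hs1) hs
  · rw [← neg_sq]
    exact sq_div_le_entropy_aux hm hx hmx hab.symm hp hb ha (by linarith)
      (le_trans (neg_le_abs _) hs1) (by linarith)

/-- The integrated exponential `(1 - e^{-ty}) / t` is Lipschitz in `t`. -/
theorem abs_one_sub_exp_div_sub_le_aux {t d y : ℝ} (ht : 0 < t) (hd : 0 ≤ d) (hy : 0 ≤ y)
    (hy1 : y ≤ 1) : |(1 - Real.exp (-(t * y))) / t - (1 - Real.exp (-((t + d) * y))) / (t + d)| ≤ d := by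
  -- The quotient is `∫_0^y e^{-tz} dz`, whose derivative in `t` is at most `y²/2` in size; this is
  -- replaced by polynomial bounds on the two exponentials.
  set E := Real.exp (-(t * y))
  set D := Real.exp (-(d * y))
  have hE : Real.exp (-((t + d) * y)) = E * D := by
    rw [← Real.exp_add]; congr 1; ring
  have hE0 : 0 < E := Real.exp_pos _
  have hty : 0 ≤ t * y := by positivity
  have hdy : 0 ≤ d * y := by positivity
  have hE1 : E ≤ 1 := Real.exp_le_one_iff.2 (by linarith)
  have hE2 : 1 - t * y ≤ E := by linarith [Real.add_one_le_exp (-(t * y))]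
  have hE3 : E * (1 + t * y) ≤ 1 := by
    have h := mul_le_mul_of_nonneg_left (Real.add_one_le_exp (t * y)) hE0.le
    rw [← Real.exp_add] at h
    simp only [neg_add_cancel, Real.exp_zero] at h
    linarith
  have hD1 : 1 - d * y ≤ D := by linarith [Real.add_one_le_exp (-(d * y))]
  have hD2 : D ≤ 1 - d * y + (d * y) ^ 2 := by
    have h : D * (1 + d * y) ≤ 1 := by
      have h := mul_le_mul_of_nonneg_left (Real.add_one_le_exp (d * y)) (Real.exp_pos (-(d * y))).le
      rw [← Real.exp_add] at h
      simp only [neg_add_cancel, Real.exp_zero] at h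
      linarith
    have h2 : (1 + d * y) * D ≤ (1 + d * y) * (1 - d * y + (d * y) ^ 2) := by
      nlinarith [pow_nonneg hdy 3]
    exact le_of_mul_le_mul_left h2 (by linarith)
  rw [hE, div_sub_div _ _ ht.ne' (by positivity), abs_le, le_div_iff₀ (by positivity),
    div_le_iff₀ (by positivity)]
  have key : (1 - E) * (t + d) - t * (1 - E * D) = d * (1 - E) - t * (E * (1 - D)) := by ring
  rw [key]
  have l1 : d * (E * (t * y)) ≤ d * (1 - E) := mul_le_mul_of_nonneg_left (by linarith) hd
  have l2 : t * (E * (1 - D)) ≤ t * (E * (d * y)) := by gcongr; linarith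
  have l3 : d * (1 - E) ≤ d * (t * y) := mul_le_mul_of_nonneg_left (by linarith) hd
  have l4 : t * (E * (d * y - (d * y) ^ 2)) ≤ t * (E * (1 - D)) :=
    mul_le_mul_of_nonneg_left (mul_le_mul_of_nonneg_left (by linarith) hE0.le) ht.le
  have hdt : 0 ≤ d * t := by positivity
  have hy2 : y ^ 2 ≤ 1 := by nlinarith
  constructor
  · have : 0 ≤ d * (t * (t + d)) := by positivity
    nlinarith
  · have h1 : t * d * y * (1 - E) ≤ t * d * y * (t * y) := by gcongr; linarith
    have h2 : t * E * (d * y) ^ 2 ≤ t * 1 * (d * y) ^ 2 := by gcongr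
    have h3 : t * d * (t + d) * y ^ 2 ≤ t * d * (t + d) * 1 := by gcongr
    nlinarith

theorem abs_one_sub_exp_div_sub_le {t θ y : ℝ} (ht : 0 < t) (hθ : 0 < θ) (hy : 0 ≤ y)
    (hy1 : y ≤ 1) :
    |(1 - Real.exp (-(t * y))) / t - (1 - Real.exp (-(θ * y))) / θ| ≤ |t - θ| := by
  rcases le_total t θ with h | h
  · have := abs_one_sub_exp_div_sub_le_aux ht (sub_nonneg.2 h) hy hy1
    rw [add_sub_cancel] at this
    rwa [abs_sub_comm t θ, abs_of_nonneg (sub_nonneg.2 h)]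
  · have := abs_one_sub_exp_div_sub_le_aux hθ (sub_nonneg.2 h) hy hy1
    rw [add_sub_cancel] at this
    rwa [abs_sub_comm, abs_of_nonneg (sub_nonneg.2 h)]

theorem one_sub_exp_div_mem {t y : ℝ} (ht : 0 < t) (hy : 0 ≤ y) (hy1 : y ≤ 1) :
    0 ≤ (1 - Real.exp (-(t * y))) / t ∧ (1 - Real.exp (-(t * y))) / t ≤ 1 := by
  have hty : 0 ≤ t * y := by positivity
  constructor
  · exact div_nonneg (by linarith [Real.exp_le_one_iff.2 (neg_nonpos.2 hty)]) ht.le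
  · rw [div_le_one ht]
    have := Real.add_one_le_exp (-(t * y))
    nlinarith

end Entropy

/-! ### Exponential tilting and KL duality on a finite set. -/

section Tilt

variable {U : Type*} [Fintype U]

/-- The partition function `∑ m e^{-tf}`. -/
noncomputable def partZ (m f : U → ℝ) (t : ℝ) : ℝ := ∑ u, m u * Real.exp (-(t * f u))

/-- The density `e^{-tf} / ∑ m e^{-tf}` of the exponentially tilted distribution. -/
noncomputable def tiltDensity (m f : U → ℝ) (t : ℝ) (u : U) : ℝ :=
  Real.exp (-(t * f u)) / partZ m f t

/-- The relative entropy of the tilted distribution. -/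
noncomputable def tiltEntropy (m f : U → ℝ) (t : ℝ) : ℝ :=
  ∑ u, m u * (tiltDensity m f t u * Real.log (tiltDensity m f t u))

/-- Nonnegative weights of total mass one. -/
structure IsWeight (m : U → ℝ) : Prop where
  nonneg : ∀ u, 0 ≤ m u
  sum_eq_one : ∑ u, m u = 1

variable {m f : U → ℝ} {t : ℝ}

theorem IsWeight.exists_pos (hm : IsWeight m) : ∃ u, 0 < m u := by
  by_contra! h
  have := Finset.sum_nonpos (s := Finset.univ) fun u _ => h u
  rw [hm.sum_eq_one] at this
  linarith

theorem IsWeight.partZ_pos (hm : IsWeight m) : 0 < partZ m f t := by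
  obtain ⟨u, hu⟩ := hm.exists_pos
  exact Finset.sum_pos' (fun u _ => mul_nonneg (hm.nonneg u) (Real.exp_pos _).le)
    ⟨u, Finset.mem_univ u, mul_pos hu (Real.exp_pos _)⟩

theorem IsWeight.tiltDensity_pos (hm : IsWeight m) (u : U) : 0 < tiltDensity m f t u :=
  div_pos (Real.exp_pos _) hm.partZ_pos

theorem IsWeight.sum_mul_tiltDensity (hm : IsWeight m) : ∑ u, m u * tiltDensity m f t u = 1 := by
  simp only [tiltDensity, ← mul_div_assoc, ← Finset.sum_div]
  exact div_self hm.partZ_pos.ne'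

theorem IsWeight.log_tiltDensity (hm : IsWeight m) (u : U) :
    Real.log (tiltDensity m f t u) = -(t * f u) - Real.log (partZ m f t) := by
  rw [tiltDensity, Real.log_div (Real.exp_pos _).ne' hm.partZ_pos.ne', Real.log_exp]

theorem IsWeight.tiltEntropy_eq (hm : IsWeight m) :
    tiltEntropy m f t = -(t * ∑ u, m u * tiltDensity m f t u * f u) - Real.log (partZ m f t) := by
  have h : ∀ u, m u * (tiltDensity m f t u * Real.log (tiltDensity m f t u)) =
      -(t * (m u * tiltDensity m f t u * f u))
        - m u * tiltDensity m f t u * Real.log (partZ m f t) := fun u => by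
    rw [hm.log_tiltDensity]; ring
  simp only [tiltEntropy, h, Finset.sum_sub_distrib, ← Finset.sum_mul, hm.sum_mul_tiltDensity,
    Finset.sum_neg_distrib, ← Finset.mul_sum, one_mul]

/-- The KL dual objective `-α log (∑ m e^{-f/α}) - αδ` in terms of `t = 1/α`. -/
noncomputable def klDual (m f : U → ℝ) (δ t : ℝ) : ℝ := -(Real.log (partZ m f t) + δ) / t

/-- Weak duality. -/
theorem klDual_le_of_entropy_le (hm : IsWeight m) {r : U → ℝ} (hr : IsWeight r)
    (hrm : ∀ u, m u = 0 → r u = 0) {δ : ℝ}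
    (hδ : ∑ u, r u * Real.log (r u / m u) ≤ δ) (ht : 0 < t) :
    klDual m f δ t ≤ ∑ u, r u * f u := by
  -- This is `log z ≤ z - 1` at `z = m w / r`, with `w` the tilted density; summed over `u` it is
  -- the nonnegativity of the entropy of `r` relative to the tilted law.
  have key : ∀ u, r u * (-(t * f u) - Real.log (partZ m f t) - Real.log (r u / m u)) ≤
      m u * tiltDensity m f t u - r u := by
    intro u
    rcases (hr.nonneg u).eq_or_lt with h | h
    · rw [← h]
      simpa using mul_nonneg (hm.nonneg u) (hm.tiltDensity_pos u).le
    · have hmu : 0 < m u := (hm.nonneg u).lt_of_ne' fun h' => h.ne' (hrm u h')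
      have hw := hm.tiltDensity_pos (f := f) (t := t) u
      rw [← hm.log_tiltDensity, ← Real.log_div hw.ne' (by positivity)]
      have := Real.log_le_sub_one_of_pos (x := tiltDensity m f t u / (r u / m u)) (by positivity)
      calc _ ≤ r u * (tiltDensity m f t u / (r u / m u) - 1) := by gcongr
        _ = _ := by field_simp
  have hsum := Finset.sum_le_sum fun u (_ : u ∈ Finset.univ) => key u
  have h1 : ∑ u, r u * (-(t * f u) - Real.log (partZ m f t) - Real.log (r u / m u)) =
      -(t * ∑ u, r u * f u) - Real.log (partZ m f t) - ∑ u, r u * Real.log (r u / m u) := by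
    simp only [mul_sub, Finset.sum_sub_distrib, ← Finset.sum_mul, hr.sum_eq_one, one_mul]
    rw [Finset.mul_sum, ← Finset.sum_neg_distrib]
    congr 2
    exact Finset.sum_congr rfl fun u _ => by ring
  rw [h1, Finset.sum_sub_distrib, hm.sum_mul_tiltDensity, hr.sum_eq_one] at hsum
  rw [klDual, div_le_iff₀ ht]
  linarith

/-- When the entropy of the tilted distribution is `δ`, the dual objective is its mean. -/
theorem IsWeight.klDual_eq (hm : IsWeight m) {δ : ℝ} (ht : 0 < t) (h : tiltEntropy m f t = δ) :
    klDual m f δ t = ∑ u, m u * tiltDensity m f t u * f u := by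
  rw [klDual, ← h, hm.tiltEntropy_eq]
  field_simp
  ring

theorem IsWeight.continuous_tiltEntropy (hm : IsWeight m) : Continuous (tiltEntropy m f) := by
  have h1 : Continuous (partZ m f) := by unfold partZ; fun_prop
  have h2 : ∀ u, Continuous fun t => tiltDensity m f t u := fun u => by
    unfold tiltDensity
    exact Continuous.div (by fun_prop) h1 fun t => hm.partZ_pos.ne'
  unfold tiltEntropy
  refine continuous_finsetSum _ fun u _ => continuous_const.mul ((h2 u).mul ?_)
  exact (h2 u).log fun t => (hm.tiltDensity_pos u).ne'

/-- The weights give mass at least `p` to points where `f` takes the values `0` and `1`, and `f`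
takes values in `[0,1]` on the support. -/
structure IsNormalized (m f : U → ℝ) (p : ℝ) : Prop extends IsWeight m where
  mem : ∀ u, m u ≠ 0 → 0 ≤ f u ∧ f u ≤ 1
  exists_zero : ∃ a, f a = 0 ∧ p ≤ m a
  exists_one : ∃ b, f b = 1 ∧ p ≤ m b

variable {p : ℝ}

/-- Intermediate value theorem: the entropy vanishes at `t = 0`, and at `t = 1` the log-density
differs by one between the points where `f` is `0` and `1`, so it is at least `p/16`. A small radius
thus keeps the dual variable `α = 1/t` away from its degenerate value `0`. -/
theorem IsNormalized.exists_tiltEntropy_eq (h : IsNormalized m f p) (hp : 0 ≤ p) {δ : ℝ} (hδ : 0 < δ)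
    (hδp : δ ≤ p / 16) : ∃ t, 0 < t ∧ t ≤ 1 ∧ tiltEntropy m f t = δ := by
  obtain ⟨a, ha, hpa⟩ := h.exists_zero
  obtain ⟨b, hb, hpb⟩ := h.exists_one
  have hm := h.toIsWeight
  have h0 : tiltEntropy m f 0 = 0 := by
    simp [tiltEntropy, tiltDensity, partZ, hm.sum_eq_one]
  have h1 : p / 16 ≤ tiltEntropy m f 1 := by
    have hab : a ≠ b := by rintro rfl; linarith
    have := sq_div_le_entropy (s := 1) hm.nonneg (fun u => hm.tiltDensity_pos (f := f) (t := 1) u)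
      (by rw [hm.sum_mul_tiltDensity, hm.sum_eq_one]) hab hp hpa hpb (by simp)
      (by rw [hm.log_tiltDensity, hm.log_tiltDensity, ha, hb]; ring)
    simpa [tiltEntropy] using this
  obtain ⟨t, ht, hte⟩ := intermediate_value_Icc zero_le_one hm.continuous_tiltEntropy.continuousOn
    (show δ ∈ Set.Icc (tiltEntropy m f 0) (tiltEntropy m f 1) from
      ⟨h0.symm ▸ hδ.le, hδp.trans h1⟩)
  refine ⟨t, ht.1.lt_of_ne ?_, ht.2, hte⟩
  rintro rfl
  linarith

end Tilt

/-! ### Second-order expansion of the dual objective in the distribution. -/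

section Expansion

variable {U : Type*} [Fintype U] {m f : U → ℝ} {p t θ : ℝ}

/-- The influence function `(1 - w) / t` of the dual value, where `w` is the tilted density. -/
noncomputable def tiltScore (m f : U → ℝ) (t : ℝ) (u : U) : ℝ := (1 - tiltDensity m f t u) / t

theorem abs_sum_mul_le_of_abs_le (hm : IsWeight m) {g : U → ℝ} {C : ℝ}
    (hg : ∀ u, m u ≠ 0 → |g u| ≤ C) : |∑ u, m u * g u| ≤ C := by
  calc |∑ u, m u * g u| ≤ ∑ u, |m u * g u| := Finset.abs_sum_le_sum_abs _ _
    _ ≤ ∑ u, m u * C := by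
        refine Finset.sum_le_sum fun u _ => ?_
        rw [abs_mul, abs_of_nonneg (hm.nonneg u)]
        by_cases h : m u = 0
        · simp [h]
        · exact mul_le_mul_of_nonneg_left (hg u h) (hm.nonneg u)
    _ = C := by rw [← Finset.sum_mul, hm.sum_eq_one, one_mul]

theorem sum_mul_le_of_le (hm : IsWeight m) {g : U → ℝ} {C : ℝ}
    (hg : ∀ u, m u ≠ 0 → g u ≤ C) : ∑ u, m u * g u ≤ C := by
  calc ∑ u, m u * g u ≤ ∑ u, m u * C := by
        refine Finset.sum_le_sum fun u _ => ?_
        by_cases h : m u = 0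
        · simp [h]
        · exact mul_le_mul_of_nonneg_left (hg u h) (hm.nonneg u)
    _ = C := by rw [← Finset.sum_mul, hm.sum_eq_one, one_mul]

theorem le_sum_mul_of_le (hm : IsWeight m) {g : U → ℝ} {C : ℝ}
    (hg : ∀ u, m u ≠ 0 → C ≤ g u) : C ≤ ∑ u, m u * g u := by
  have := sum_mul_le_of_le hm (g := fun u => -g u) (C := -C) fun u hu => neg_le_neg (hg u hu)
  simp only [mul_neg, Finset.sum_neg_distrib] at this
  linarith

namespace IsNormalized

variable (h : IsNormalized m f p)
include h

theorem exp_mem (ht : 0 < t) (ht1 : t ≤ 1) {u : U} (hu : m u ≠ 0) :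
    1 / 3 ≤ Real.exp (-(t * f u)) ∧ Real.exp (-(t * f u)) ≤ 1 := by
  obtain ⟨h0, h1⟩ := h.mem u hu
  have h2 : t * f u ≤ 1 := mul_le_one₀ ht1 h0 h1
  refine ⟨?_, Real.exp_le_one_iff.2 (neg_nonpos.2 (mul_nonneg ht.le h0))⟩
  calc (1 / 3 : ℝ) ≤ Real.exp (-1) := by
        rw [Real.exp_neg, one_div]
        exact inv_anti₀ (Real.exp_pos _) (by linarith [Real.exp_one_lt_d9])
    _ ≤ _ := Real.exp_le_exp.2 (by linarith)

theorem partZ_mem (ht : 0 < t) (ht1 : t ≤ 1) : 1 / 3 ≤ partZ m f t ∧ partZ m f t ≤ 1 :=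
  ⟨le_sum_mul_of_le h.toIsWeight fun _ hu => (h.exp_mem ht ht1 hu).1,
    sum_mul_le_of_le h.toIsWeight fun _ hu => (h.exp_mem ht ht1 hu).2⟩

theorem one_third_le_tiltDensity (ht : 0 < t) (ht1 : t ≤ 1) {u : U} (hu : m u ≠ 0) :
    1 / 3 ≤ tiltDensity m f t u := by
  have hZ := h.partZ_mem ht ht1
  rw [tiltDensity, le_div_iff₀ (by linarith)]
  linarith [(h.exp_mem ht ht1 hu).1]

-- Centring removes the apparent singularity at `t = 0`: the score is a difference of integrated
-- exponentials, bounded and Lipschitz uniformly in `t`, divided by a partition function that is at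
-- least `1/3`.
omit h in
theorem tiltScore_eq (hm : IsWeight m) (ht : 0 < t) (u : U) :
    tiltScore m f t u = ((1 - Real.exp (-(t * f u))) / t
      - ∑ u, m u * ((1 - Real.exp (-(t * f u))) / t)) / partZ m f t := by
  have h1 : ∑ u, m u * ((1 - Real.exp (-(t * f u))) / t) = (1 - partZ m f t) / t := by
    simp only [← mul_div_assoc, ← Finset.sum_div, mul_sub, mul_one, Finset.sum_sub_distrib,
      hm.sum_eq_one, partZ]
  have := (hm.partZ_pos (f := f) (t := t)).ne'
  rw [h1, tiltScore, tiltDensity]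
  field_simp
  ring

theorem abs_centered_le (ht : 0 < t) {u : U} (hu : m u ≠ 0) :
    |(1 - Real.exp (-(t * f u))) / t - ∑ u, m u * ((1 - Real.exp (-(t * f u))) / t)| ≤ 1 := by
  have h1 := fun u hu => one_sub_exp_div_mem ht (h.mem u hu).1 (h.mem u hu).2
  have h2 := le_sum_mul_of_le h.toIsWeight fun u hu => (h1 u hu).1
  have h3 := sum_mul_le_of_le h.toIsWeight fun u hu => (h1 u hu).2
  have h4 := h1 u hu
  rw [abs_le]
  constructor <;> linarith [h4.1, h4.2]

theorem abs_tiltScore_le (ht : 0 < t) (ht1 : t ≤ 1) {u : U} (hu : m u ≠ 0) :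
    |tiltScore m f t u| ≤ 3 := by
  have hZ := (h.partZ_mem ht ht1).1
  have hZ0 : 0 < partZ m f t := by linarith
  rw [tiltScore_eq h.toIsWeight ht, abs_div, abs_of_pos hZ0, div_le_iff₀ hZ0]
  linarith [h.abs_centered_le ht hu]

theorem abs_partZ_sub_le (ht : 0 < t) (hθ : 0 < θ) : |partZ m f t - partZ m f θ| ≤ |t - θ| := by
  have aux : ∀ {s r y : ℝ}, 0 < s → 0 ≤ y → y ≤ 1 →
      Real.exp (-(s * y)) - Real.exp (-(r * y)) ≤ |s - r| := by
    intro s r y hs hy hy1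
    have h1 := Real.add_one_le_exp (-((r - s) * y))
    have h2 : Real.exp (-(r * y)) = Real.exp (-(s * y)) * Real.exp (-((r - s) * y)) := by
      rw [← Real.exp_add]; congr 1; ring
    have h3 : Real.exp (-(s * y)) ≤ 1 := Real.exp_le_one_iff.2 (neg_nonpos.2 (by positivity))
    have h4 := Real.exp_pos (-(s * y))
    have h5 : (r - s) * y ≤ |s - r| := by
      rw [abs_sub_comm]
      calc (r - s) * y ≤ |r - s| * y := mul_le_mul_of_nonneg_right (le_abs_self _) hy
        _ ≤ |r - s| := mul_le_of_le_one_right (abs_nonneg _) hy1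
    rw [h2]
    calc _ = Real.exp (-(s * y)) * (1 - Real.exp (-((r - s) * y))) := by ring
      _ ≤ Real.exp (-(s * y)) * |s - r| := by gcongr; linarith
      _ ≤ |s - r| := mul_le_of_le_one_left (abs_nonneg _) h3
  rw [partZ, partZ, ← Finset.sum_sub_distrib]
  simp only [← mul_sub]
  refine abs_sum_mul_le_of_abs_le h.toIsWeight fun u hu => ?_
  have h1 := aux (r := θ) ht (h.mem u hu).1 (h.mem u hu).2
  have h2 := aux (r := t) hθ (h.mem u hu).1 (h.mem u hu).2
  rw [abs_sub_comm] at h2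
  rw [abs_le]
  constructor <;> linarith

/-- The constant is `6 + 9`: the numerator moves by at most `2|t - θ|` over `Z ≥ 1/3`, and the
denominator contributes `|t - θ|` over a product of two partition functions, at least `1/9`. -/
theorem abs_tiltScore_sub_le (ht : 0 < t) (ht1 : t ≤ 1) (hθ : 0 < θ) (hθ1 : θ ≤ 1) {u : U}
    (hu : m u ≠ 0) : |tiltScore m f t u - tiltScore m f θ u| ≤ 15 * |t - θ| := by
  rw [tiltScore_eq h.toIsWeight ht, tiltScore_eq h.toIsWeight hθ]
  have hk : ∀ u, m u ≠ 0 → |(1 - Real.exp (-(t * f u))) / t - (1 - Real.exp (-(θ * f u))) / θ| ≤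
      |t - θ| := fun u hu => abs_one_sub_exp_div_sub_le ht hθ (h.mem u hu).1 (h.mem u hu).2
  have hE := abs_sum_mul_le_of_abs_le h.toIsWeight hk
  simp only [mul_sub, Finset.sum_sub_distrib] at hE
  have hc := h.abs_centered_le hθ hu
  have hku := hk u hu
  set a := (1 - Real.exp (-(t * f u))) / t
  set b := (1 - Real.exp (-(θ * f u))) / θ
  set A := ∑ u, m u * ((1 - Real.exp (-(t * f u))) / t)
  set B := ∑ u, m u * ((1 - Real.exp (-(θ * f u))) / θ)
  have hZ := (h.partZ_mem ht ht1).1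
  have hY := (h.partZ_mem hθ hθ1).1
  have hZY := h.abs_partZ_sub_le ht hθ
  set Z := partZ m f t
  set Y := partZ m f θ
  have e : (a - A) / Z - (b - B) / Y = ((a - b) - (A - B)) / Z - (b - B) * (Z - Y) / (Z * Y) := by
    field_simp
    ring
  rw [e]
  have h1 : |((a - b) - (A - B)) / Z| ≤ 6 * |t - θ| := by
    rw [abs_div, abs_of_pos (show 0 < Z by linarith), div_le_iff₀ (by linarith)]
    have := abs_sub (a - b) (A - B)
    nlinarith [abs_nonneg (t - θ)]
  have h2 : |(b - B) * (Z - Y) / (Z * Y)| ≤ 9 * |t - θ| := by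
    have hZY9 : 1 / 9 ≤ Z * Y := by nlinarith
    rw [abs_div, abs_of_pos (show 0 < Z * Y by linarith), div_le_iff₀ (by linarith), abs_mul]
    have : |b - B| * |Z - Y| ≤ 1 * |t - θ| := by gcongr
    nlinarith [abs_nonneg (t - θ)]
  linarith [abs_sub (((a - b) - (A - B)) / Z) ((b - B) * (Z - Y) / (Z * Y))]

/-- The dual objective is strongly concave around its maximiser. -/
theorem klDual_le_sub (hp : 0 < p) {δ : ℝ} (ht : 0 < t) (ht1 : t ≤ 1) (hθ : 0 < θ) (hθ1 : θ ≤ 1)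
    (hδ : tiltEntropy m f θ = δ) :
    klDual m f δ t ≤ klDual m f δ θ - p * (t - θ) ^ 2 / 48 := by
  have hm := h.toIsWeight
  obtain ⟨a, ha, hpa⟩ := h.exists_zero
  obtain ⟨b, hb, hpb⟩ := h.exists_one
  have hab : a ≠ b := by rintro rfl; linarith
  have hw := fun u => hm.tiltDensity_pos (f := f) (t := t) u
  have hv := fun u => hm.tiltDensity_pos (f := f) (t := θ) u
  have hpos : ∀ {u}, p ≤ m u → p / 3 ≤ m u * tiltDensity m f t u := fun {u} hu => by
    have := h.one_third_le_tiltDensity ht ht1 (u := u) (by linarith)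
    nlinarith
  have key := sq_div_le_entropy (m := fun u => m u * tiltDensity m f t u)
    (x := fun u => tiltDensity m f θ u / tiltDensity m f t u) (a := a) (b := b) (p := p / 3)
    (s := θ - t)
    (fun u => mul_nonneg (hm.nonneg u) (hw u).le) (fun u => div_pos (hv u) (hw u)) (by
      have : ∀ u, m u * tiltDensity m f t u * (tiltDensity m f θ u / tiltDensity m f t u) =
        m u * tiltDensity m f θ u := fun u => by field_simp [(hw u).ne']
      simp only [this, hm.sum_mul_tiltDensity]) hab (by positivity) (hpos hpa) (hpos hpb)
    (by rw [abs_le]; constructor <;> linarith) (by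
      simp only [Real.log_div (hv _).ne' (hw _).ne', hm.log_tiltDensity, ha, hb]; ring)
  -- The loss in the dual objective, times `t`, is exactly the relative entropy of the tilt at `θ`
  -- with respect to the tilt at `t`. The two-point bound applies with masses at least `p/3` and
  -- log-ratio difference `θ - t`, whence `48 = 3 · 16`.
  have hsum : ∑ u, m u * tiltDensity m f t u * (tiltDensity m f θ u / tiltDensity m f t u *
      Real.log (tiltDensity m f θ u / tiltDensity m f t u)) =
      t * (klDual m f δ θ - klDual m f δ t) := by
    have e : ∀ u, m u * tiltDensity m f t u * (tiltDensity m f θ u / tiltDensity m f t u *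
      Real.log (tiltDensity m f θ u / tiltDensity m f t u)) =
      m u * (tiltDensity m f θ u * Real.log (tiltDensity m f θ u)) +
        t * (m u * tiltDensity m f θ u * f u) +
        m u * tiltDensity m f θ u * Real.log (partZ m f t) := fun u => by
      rw [Real.log_div (hv u).ne' (hw u).ne', hm.log_tiltDensity (t := t)]
      field_simp [(hw u).ne']
      ring
    simp only [e, Finset.sum_add_distrib, ← Finset.mul_sum, ← Finset.sum_mul,
      hm.sum_mul_tiltDensity]
    have hd := hδ
    rw [tiltEntropy] at hd
    rw [hd, hm.klDual_eq hθ hδ, klDual]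
    field_simp
    ring
  rw [hsum] at key
  have h0 : 0 ≤ klDual m f δ θ - klDual m f δ t :=
    (mul_nonneg_iff_of_pos_left ht).1 (le_trans (by positivity) key)
  nlinarith

end IsNormalized

/-- The partition function is linear in the weights, so at fixed `t` the dependence on `m'` is
exact; the only nonlinearity left in the dual objective is a logarithm of one scalar. -/
theorem IsWeight.sum_sub_mul_tiltScore {m' : U → ℝ} (hm : IsWeight m) (hm' : IsWeight m')
    (ht : 0 < t) : partZ m' f t = partZ m f t * (1 - t * ∑ u, (m' u - m u) * tiltScore m f t u) := by
  have h1 : ∀ u, (m' u - m u) * tiltScore m f t u =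
      ((m' u - m u) - (m' u * Real.exp (-(t * f u)) / partZ m f t - m u * tiltDensity m f t u)) / t :=
    fun u => by rw [tiltScore, tiltDensity]; ring
  simp only [h1, ← Finset.sum_div, Finset.sum_sub_distrib, hm.sum_eq_one, hm'.sum_eq_one,
    hm.sum_mul_tiltDensity]
  have := (hm.partZ_pos (f := f) (t := t)).ne'
  rw [← partZ]
  field_simp
  ring

theorem IsWeight.klDual_eq_sub {m' : U → ℝ} (hm : IsWeight m) (hm' : IsWeight m') (ht : 0 < t)
    (δ : ℝ) :
    0 < 1 - t * ∑ u, (m' u - m u) * tiltScore m f t u ∧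
    klDual m' f δ t = klDual m f δ t -
      Real.log (1 - t * ∑ u, (m' u - m u) * tiltScore m f t u) / t := by
  have h1 := hm.sum_sub_mul_tiltScore hm' ht (f := f)
  have h2 := hm.partZ_pos (f := f) (t := t)
  have h3 := hm'.partZ_pos (f := f) (t := t)
  rw [h1] at h3
  have h4 := (mul_pos_iff_of_pos_left h2).1 h3
  refine ⟨h4, ?_⟩
  rw [klDual, klDual, h1, Real.log_mul h2.ne' h4.ne']
  ring

theorem IsWeight.klDual_add_le {m' : U → ℝ} (hm : IsWeight m) (hm' : IsWeight m') (ht : 0 < t)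
    (δ : ℝ) :
    klDual m f δ t + ∑ u, (m' u - m u) * tiltScore m f t u ≤ klDual m' f δ t := by
  obtain ⟨h1, h2⟩ := hm.klDual_eq_sub hm' ht (f := f) δ
  have h3 := Real.log_le_sub_one_of_pos h1
  have h4 := div_le_div_of_nonneg_right h3 ht.le
  have h5 : (1 - t * ∑ u, (m' u - m u) * tiltScore m f t u - 1) / t =
    -∑ u, (m' u - m u) * tiltScore m f t u := by field_simp; ring
  linarith

/-- Rests on `-log (1 - y) ≤ y + 2y²` for `|y| ≤ 1/2`, at `y = ts`. The matching lower bound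
`klDual_add_le` needs no smallness. -/
theorem IsWeight.klDual_le_add {m' : U → ℝ} (hm : IsWeight m) (hm' : IsWeight m') (ht : 0 < t)
    (ht1 : t ≤ 1) (δ : ℝ) (hs : |∑ u, (m' u - m u) * tiltScore m f t u| ≤ 1 / 2) :
    klDual m' f δ t ≤ klDual m f δ t + ∑ u, (m' u - m u) * tiltScore m f t u +
      2 * (∑ u, (m' u - m u) * tiltScore m f t u) ^ 2 := by
  obtain ⟨h1, h2⟩ := hm.klDual_eq_sub hm' ht (f := f) δ
  set s := ∑ u, (m' u - m u) * tiltScore m f t u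
  have hy : |t * s| ≤ 1 / 2 := by
    rw [abs_mul, abs_of_pos ht]
    exact (mul_le_of_le_one_left (abs_nonneg _) ht1).trans hs
  rw [abs_le] at hy
  have h3 := Real.one_sub_inv_le_log_of_pos h1
  have h4 : (1 - t * s)⁻¹ ≤ 1 + t * s + 2 * (t * s) ^ 2 := by
    rw [inv_le_iff_one_le_mul₀ h1]
    nlinarith [mul_nonneg (sq_nonneg (t * s)) (show 0 ≤ 1 - 2 * (t * s) by linarith)]
  have h5 : -(t * s + 2 * (t * s) ^ 2) / t ≤ Real.log (1 - t * s) / t :=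
    div_le_div_of_nonneg_right (by linarith) ht.le
  have h6 : -(t * s + 2 * (t * s) ^ 2) / t = -s - 2 * (t * s ^ 2) := by field_simp; ring
  have h7 : t * s ^ 2 ≤ s ^ 2 := mul_le_of_le_one_left (sq_nonneg s) ht1
  linarith

variable {m' : U → ℝ} {ξ : ℝ}

theorem abs_sum_sub_mul_le (hm : IsWeight m) {g : U → ℝ} {C : ℝ}
    (hg : ∀ u, m u ≠ 0 → |g u| ≤ C) (hξ : ∀ u, |m' u - m u| ≤ ξ * m u) :
    |∑ u, (m' u - m u) * g u| ≤ C * ξ := by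
  calc |∑ u, (m' u - m u) * g u| ≤ ∑ u, |(m' u - m u) * g u| := Finset.abs_sum_le_sum_abs _ _
    _ ≤ ∑ u, (ξ * m u) * C := by
        refine Finset.sum_le_sum fun u _ => ?_
        rw [abs_mul]
        by_cases h : m u = 0
        · have := hξ u
          rw [h, mul_zero, sub_zero] at this
          simp [h, abs_eq_zero.1 (le_antisymm this (abs_nonneg _))]
        · exact mul_le_mul (hξ u) (hg u h) (abs_nonneg _) ((abs_nonneg _).trans (hξ u))
    _ = C * ξ := by rw [← Finset.sum_mul, ← Finset.mul_sum, hm.sum_eq_one]; ring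

/-- If `m'` is relatively close to `m` then it is normalized as well. -/
theorem IsNormalized.of_close (h : IsNormalized m f p) (hm' : IsWeight m')
    (hξ : ∀ u, |m' u - m u| ≤ ξ * m u) (hξ1 : ξ ≤ 1 / 2) : IsNormalized m' f (p / 2) := by
  have hle : ∀ {u}, p ≤ m u → p / 2 ≤ m' u := fun {u} hu => by
    have h1 := (abs_le.1 (hξ u)).1
    have h2 : ξ * m u ≤ 1 / 2 * m u := mul_le_mul_of_nonneg_right hξ1 (h.nonneg u)
    linarith
  obtain ⟨a, ha, hpa⟩ := h.exists_zero
  obtain ⟨b, hb, hpb⟩ := h.exists_one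
  refine ⟨hm', fun u hu => h.mem u fun h0 => hu ?_, ⟨a, ha, hle hpa⟩, ⟨b, hb, hle hpb⟩⟩
  have := hξ u
  rw [h0, mul_zero, sub_zero] at this
  exact abs_eq_zero.1 (le_antisymm this (abs_nonneg _))

/-- Second-order expansion of the dual objective at a nearby distribution. -/
theorem IsNormalized.klDual_expansion (h : IsNormalized m f p) (hp : 0 < p) (hm' : IsWeight m')
    (hξ : ∀ u, |m' u - m u| ≤ ξ * m u) (hξ0 : 0 ≤ ξ) (hξ1 : ξ ≤ 1 / 6) {δ : ℝ}
    (ht : 0 < t) (ht1 : t ≤ 1) (hθ : 0 < θ) (hθ1 : θ ≤ 1) (hδ : tiltEntropy m f θ = δ) :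
    klDual m' f δ t ≤ klDual m f δ θ + 6 * ξ ∧
    klDual m' f δ t ≤ klDual m f δ θ + ∑ u, (m' u - m u) * tiltScore m f θ u + 2718 * ξ ^ 2 / p := by
  have hm := h.toIsWeight
  have h1 := abs_sum_sub_mul_le hm (fun u hu => h.abs_tiltScore_le ht ht1 hu) hξ
  have h2 := hm.klDual_le_add hm' ht ht1 (f := f) δ (by linarith)
  have h3 := h.klDual_le_sub hp ht ht1 hθ hθ1 hδ
  have h4 := abs_sum_sub_mul_le hm
    (fun u hu => h.abs_tiltScore_sub_le ht ht1 hθ hθ1 hu) hξ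
  simp only [mul_sub, Finset.sum_sub_distrib] at h4
  set s := ∑ u, (m' u - m u) * tiltScore m f t u
  set r := ∑ u, (m' u - m u) * tiltScore m f θ u
  have h5 : s ^ 2 ≤ 9 * ξ ^ 2 := by
    rw [← sq_abs]; nlinarith [abs_nonneg s]
  have h6 : 0 ≤ p * (t - θ) ^ 2 / 48 := by positivity
  constructor
  · nlinarith [le_abs_self s]
  -- Changing the score from `t` to `θ` costs `15 |t - θ| ξ`, which the quadratic drop at the
  -- maximiser absorbs by completing the square: `2700 = 15² · 48 / 4`. The remaining `18` is `2 ·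
  -- 3²`, from the remainder `2s²` with `|s| ≤ 3ξ`.
  · have h7 : 15 * |t - θ| * ξ ≤ p * (t - θ) ^ 2 / 48 + 2700 * ξ ^ 2 / p := by
      rw [← sq_abs (t - θ)]
      have : 0 ≤ (p * |t - θ| - 360 * ξ) ^ 2 / (48 * p) := by positivity
      have e : (p * |t - θ| - 360 * ξ) ^ 2 / (48 * p) =
          p * |t - θ| ^ 2 / 48 + 2700 * ξ ^ 2 / p - 15 * |t - θ| * ξ := by
        field_simp; ring
      linarith
    have hp1 : p ≤ 1 := by
      obtain ⟨a, _, hpa⟩ := h.exists_zero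
      have := Finset.single_le_sum (fun u _ => hm.nonneg u) (Finset.mem_univ a)
      rw [hm.sum_eq_one] at this
      linarith
    have h8 : 18 * ξ ^ 2 ≤ 18 * ξ ^ 2 / p := by
      rw [le_div_iff₀ hp]
      exact mul_le_of_le_one_right (by positivity) hp1
    have h9 : 2718 * ξ ^ 2 / p = 2700 * ξ ^ 2 / p + 18 * ξ ^ 2 / p := by ring
    linarith [le_abs_self (s - r)]

end Expansion

/-! ### The empirical dual value: duality, monotonicity, scaling. -/

section Empirical

variable {U : Type*} {n : ℕ}

/-- The empirical frequencies of a sample. -/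
noncomputable def empWeight (x : Fin n → U) (u : U) : ℝ :=
  (∑ i, Set.indicator {u} (1 : U → ℝ) (x i)) / n

theorem sum_empWeight_mul [Fintype U] (x : Fin n → U) (g : U → ℝ) :
    ∑ u, empWeight x u * g u = (∑ i, g (x i)) / n := by
  classical
  simp only [empWeight, div_mul_eq_mul_div, ← Finset.sum_div, Finset.sum_mul]
  rw [Finset.sum_comm]
  congr 1
  refine Finset.sum_congr rfl fun i _ => ?_
  rw [Finset.sum_eq_single (x i)]
  · simp
  · intro u _ hu
    simp [hu.symm]
  · simp

theorem isWeight_empWeight [Fintype U] (hn : n ≠ 0) (x : Fin n → U) : IsWeight (empWeight x) := by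
  refine ⟨fun u => div_nonneg (Finset.sum_nonneg fun i _ => ?_) (Nat.cast_nonneg n), ?_⟩
  · exact Set.indicator_nonneg (fun _ _ => zero_le_one) _
  · have := sum_empWeight_mul x (fun _ => 1)
    simp only [mul_one, Finset.sum_const, Finset.card_univ, Fintype.card_fin, nsmul_eq_mul] at this
    rw [this, div_self (by exact_mod_cast hn)]

theorem exists_of_empWeight_ne_zero {x : Fin n → U} {u : U} (h : empWeight x u ≠ 0) :
    ∃ i, x i = u := by
  by_contra! hx
  exact h (by simp [empWeight, hx])

theorem empDualObj_eq_klDual [Fintype U] (x : Fin n → U) (f : U → ℝ) (δ : ℝ) {α : ℝ} (hα : 0 < α) :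
    empDualObj x f δ α = klDual (empWeight x) f δ α⁻¹ := by
  rw [empDualObj, if_neg hα.ne', klDual, partZ, sum_empWeight_mul]
  have : ∀ i, -f (x i) / α = -(α⁻¹ * f (x i)) := fun i => by ring
  simp only [this]
  rw [div_inv_eq_mul]
  ring

theorem empDualObj_le_sum [Fintype U] (hn : n ≠ 0) (x : Fin n → U) (f : U → ℝ) {δ α : ℝ}
    (hα : 0 ≤ α) {r : U → ℝ} (hr : IsWeight r) (hrx : ∀ u, empWeight x u = 0 → r u = 0)
    (hδ : ∑ u, r u * Real.log (r u / empWeight x u) ≤ δ) :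
    empDualObj x f δ α ≤ ∑ u, r u * f u := by
  rcases hα.eq_or_lt with rfl | hα
  · rw [empDualObj, if_pos rfl]
    refine le_sum_mul_of_le hr fun u hu => ?_
    obtain ⟨i, rfl⟩ := exists_of_empWeight_ne_zero fun h => hu (hrx u h)
    exact ciInf_le (Set.finite_range _).bddBelow i
  · rw [empDualObj_eq_klDual x f δ hα]
    exact klDual_le_of_entropy_le (isWeight_empWeight hn x) hr hrx hδ (inv_pos.2 hα)

theorem empDualObj_le_mean [Fintype U] (hn : n ≠ 0) (x : Fin n → U) (f : U → ℝ) {δ α : ℝ}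
    (hα : 0 ≤ α) (hδ : 0 ≤ δ) : empDualObj x f δ α ≤ ∑ u, empWeight x u * f u := by
  refine empDualObj_le_sum hn x f hα (isWeight_empWeight hn x) (fun _ h => h) ?_
  refine le_trans (le_of_eq (Finset.sum_eq_zero fun u _ => ?_)) hδ
  by_cases h : empWeight x u = 0 <;> simp [h]

theorem bddAbove_empDualObj [Fintype U] (hn : n ≠ 0) (x : Fin n → U) (f : U → ℝ) {δ : ℝ}
    (hδ : 0 ≤ δ) : BddAbove (Set.range fun α : Set.Ici (0 : ℝ) => empDualObj x f δ α) := by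
  refine ⟨∑ u, empWeight x u * f u, ?_⟩
  rintro _ ⟨α, rfl⟩
  exact empDualObj_le_mean hn x f α.2 hδ

theorem empDualObj_le_empDual [Fintype U] (hn : n ≠ 0) (x : Fin n → U) (f : U → ℝ) {δ α : ℝ}
    (hδ : 0 ≤ δ) (hα : 0 ≤ α) : empDualObj x f δ α ≤ empDual x f δ :=
  le_ciSup (bddAbove_empDualObj hn x f hδ) ⟨α, hα⟩

theorem klDual_le_empDual [Fintype U] (hn : n ≠ 0) (x : Fin n → U) (f : U → ℝ) {δ t : ℝ}
    (hδ : 0 ≤ δ) (ht : 0 < t) : klDual (empWeight x) f δ t ≤ empDual x f δ := by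
  have := empDualObj_le_empDual hn x f hδ (inv_pos.2 ht).le
  rwa [empDualObj_eq_klDual x f δ (inv_pos.2 ht), inv_inv] at this

theorem empDual_le_sum [Fintype U] (hn : n ≠ 0) (x : Fin n → U) (f : U → ℝ) {δ : ℝ}
    {r : U → ℝ} (hr : IsWeight r) (hrx : ∀ u, empWeight x u = 0 → r u = 0)
    (hδ : ∑ u, r u * Real.log (r u / empWeight x u) ≤ δ) :
    empDual x f δ ≤ ∑ u, r u * f u :=
  ciSup_le fun α => empDualObj_le_sum hn x f α.2 hr hrx hδ

theorem empDual_mem [Fintype U] (hn : n ≠ 0) (x : Fin n → U) (f : U → ℝ) {δ lo hi : ℝ}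
    (hδ : 0 ≤ δ) (hlo : ∀ i, lo ≤ f (x i)) (hhi : ∀ i, f (x i) ≤ hi) :
    lo ≤ empDual x f δ ∧ empDual x f δ ≤ hi := by
  have : Nonempty (Fin n) := ⟨⟨0, Nat.pos_of_ne_zero hn⟩⟩
  constructor
  · refine le_trans ?_ (empDualObj_le_empDual hn x f hδ le_rfl)
    rw [empDualObj, if_pos rfl]
    exact le_ciInf hlo
  · refine ciSup_le fun α => (empDualObj_le_mean hn x f α.2 hδ).trans ?_
    refine sum_mul_le_of_le (isWeight_empWeight hn x) fun u hu => ?_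
    obtain ⟨i, rfl⟩ := exists_of_empWeight_ne_zero hu
    exact hhi i

theorem empDualObj_le_add (hn : n ≠ 0) (x : Fin n → U) {f g : U → ℝ} {δ α ε : ℝ}
    (hα : 0 ≤ α) (h : ∀ i, f (x i) ≤ g (x i) + ε) :
    empDualObj x f δ α ≤ empDualObj x g δ α + ε := by
  have : Nonempty (Fin n) := ⟨⟨0, Nat.pos_of_ne_zero hn⟩⟩
  rcases hα.eq_or_lt with rfl | hα
  · simp only [empDualObj, if_true]
    rw [← sub_le_iff_le_add]
    exact le_ciInf fun i => by linarith [h i, ciInf_le (Set.finite_range fun i => f (x i)).bddBelow i]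
  · simp only [empDualObj, if_neg hα.ne']
    have hn' : (0 : ℝ) < n := by exact_mod_cast Nat.pos_of_ne_zero hn
    have hpos : ∀ g : U → ℝ, 0 < (∑ i, Real.exp (-g (x i) / α)) / n := fun g =>
      div_pos (Finset.sum_pos (fun i _ => Real.exp_pos _) Finset.univ_nonempty) hn'
    have h1 : Real.exp (-(ε / α)) * ((∑ i, Real.exp (-g (x i) / α)) / n) ≤
        (∑ i, Real.exp (-f (x i) / α)) / n := by
      rw [← mul_div_assoc, Finset.mul_sum]
      gcongr with i
      rw [← Real.exp_add, Real.exp_le_exp, ← sub_nonneg]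
      have : -f (x i) / α - (-(ε / α) + -g (x i) / α) = (g (x i) + ε - f (x i)) / α := by ring
      rw [this]
      exact div_nonneg (sub_nonneg.2 (h i)) hα.le
    have h2 := Real.log_le_log (mul_pos (Real.exp_pos _) (hpos g)) h1
    rw [Real.log_mul (Real.exp_pos _).ne' (hpos g).ne', Real.log_exp] at h2
    have h3 := mul_le_mul_of_nonneg_left h2 hα.le
    have h4 : α * (-(ε / α) + Real.log ((∑ i, Real.exp (-g (x i) / α)) / n)) =
      -ε + α * Real.log ((∑ i, Real.exp (-g (x i) / α)) / n) := by field_simp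
    linarith

/-- The dual objective is monotone in the payoff and shifts with constants at every `α`; used in
both directions this makes the empirical Bellman operator a contraction for each fixed batch. -/
theorem empDual_le_add [Fintype U] (hn : n ≠ 0) (x : Fin n → U) {f g : U → ℝ} {δ ε : ℝ}
    (hδ : 0 ≤ δ) (h : ∀ i, f (x i) ≤ g (x i) + ε) : empDual x f δ ≤ empDual x g δ + ε :=
  ciSup_le fun α => (empDualObj_le_add hn x α.2 h).trans
    (add_le_add_left (empDualObj_le_empDual hn x g hδ α.2) ε)

/-- Scaling the payoff by `D` rescales the dual variable by `D`, so it suffices to study payoffs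
normalised to span `[0,1]`. -/
theorem empDualObj_affine (hn : n ≠ 0) (x : Fin n → U) (y : U → ℝ) (δ c : ℝ) {D α : ℝ}
    (hD : 0 < D) (hα : 0 ≤ α) :
    empDualObj x (fun u => c + D * y u) δ (D * α) = c + D * empDualObj x y δ α := by
  have : Nonempty (Fin n) := ⟨⟨0, Nat.pos_of_ne_zero hn⟩⟩
  rcases hα.eq_or_lt with rfl | hα
  · simp only [empDualObj, mul_zero, if_true]
    apply le_antisymm
    · rw [← sub_le_iff_le_add', ← div_le_iff₀' hD]
      refine le_ciInf fun i => ?_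
      rw [div_le_iff₀' hD, sub_le_iff_le_add']
      exact ciInf_le (Set.finite_range fun i => c + D * y (x i)).bddBelow i
    · refine le_ciInf fun i => ?_
      gcongr
      exact ciInf_le (Set.finite_range fun i => y (x i)).bddBelow i
  · simp only [empDualObj, if_neg hα.ne', if_neg (mul_pos hD hα).ne']
    have hn' : (0 : ℝ) < n := by exact_mod_cast Nat.pos_of_ne_zero hn
    have hpos : 0 < (∑ i, Real.exp (-y (x i) / α)) / n :=
      div_pos (Finset.sum_pos (fun i _ => Real.exp_pos _) Finset.univ_nonempty) hn'
    have h1 : ∀ i, Real.exp (-(c + D * y (x i)) / (D * α)) =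
        Real.exp (-(c / (D * α))) * Real.exp (-y (x i) / α) := fun i => by
      rw [← Real.exp_add]; congr 1; field_simp; ring
    simp only [h1, ← Finset.mul_sum, mul_div_assoc]
    rw [Real.log_mul (Real.exp_pos _).ne' hpos.ne', Real.log_exp]
    field_simp
    ring

theorem empDual_affine [Fintype U] (hn : n ≠ 0) (x : Fin n → U) (y : U → ℝ) (c : ℝ) {δ D : ℝ}
    (hδ : 0 ≤ δ) (hD : 0 < D) :
    empDual x (fun u => c + D * y u) δ = c + D * empDual x y δ := by
  apply le_antisymm
  · refine ciSup_le fun α => ?_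
    have h := empDualObj_affine hn x y δ c hD (div_nonneg α.2 hD.le)
    rw [mul_div_cancel₀ _ hD.ne'] at h
    rw [h]
    gcongr
    exact empDualObj_le_empDual hn x y hδ (div_nonneg α.2 hD.le)
  · rw [← le_sub_iff_add_le', ← le_div_iff₀' hD]
    refine ciSup_le fun α => ?_
    rw [le_div_iff₀' hD, le_sub_iff_add_le', ← empDualObj_affine hn x y δ c hD α.2]
    exact empDualObj_le_empDual hn x _ hδ (mul_nonneg hD.le α.2)

end Empirical

/-! ### KL balls on a finite set as finite sums. -/

section KL

variable {U : Type*} [Fintype U]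

theorem PMF.isWeight (μ : PMF U) : IsWeight fun u => (μ u).toReal :=
  ⟨fun _ => ENNReal.toReal_nonneg, by
    rw [← ENNReal.toReal_sum (fun u _ => μ.apply_ne_top u), ← tsum_fintype (L := .unconditional U),
      μ.tsum_coe, ENNReal.toReal_one]⟩

variable [MeasurableSpace U] [MeasurableSingletonClass U]

theorem toMeasure_absolutelyContinuous_iff (ρ μ : PMF U) :
    ρ.toMeasure ≪ μ.toMeasure ↔ ∀ u, μ u = 0 → ρ u = 0 := by
  constructor
  · intro h u hu
    have := @h {u}
    simpa only [PMF.toMeasure_apply_singleton _ _ (measurableSet_singleton u), hu,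
      forall_const] using this
  · intro h s hs
    rw [PMF.toMeasure_apply_fintype, Finset.sum_eq_zero_iff] at hs ⊢
    intro u hu
    have := hs u hu
    by_cases hus : u ∈ s
    · rw [Set.indicator_of_mem hus] at this ⊢
      exact h u this
    · exact Set.indicator_of_notMem hus _

theorem toReal_klDiv_eq_sum (ρ μ : PMF U) (h : ∀ u, μ u = 0 → ρ u = 0) :
    InformationTheory.klDiv ρ.toMeasure μ.toMeasure ≠ ⊤ ∧
    (InformationTheory.klDiv ρ.toMeasure μ.toMeasure).toReal =
      ∑ u, (ρ u).toReal * Real.log ((ρ u).toReal / (μ u).toReal) := by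
  have hac := (toMeasure_absolutelyContinuous_iff ρ μ).2 h
  refine ⟨InformationTheory.klDiv_ne_top hac Integrable.of_finite, ?_⟩
  rw [InformationTheory.toReal_klDiv_of_measure_eq hac (by simp), PMF.integral_eq_sum]
  refine Finset.sum_congr rfl fun u _ => ?_
  by_cases hu : μ u = 0
  · simp [h u hu]
  -- At an atom the Radon–Nikodym derivative is the ratio of the masses.
  · have h1 : (ρ.toMeasure.rnDeriv μ.toMeasure u) * μ u = ρ u := by
      have h2 := Measure.withDensity_rnDeriv_eq _ _ hac
      have h3 : (μ.toMeasure.withDensity (ρ.toMeasure.rnDeriv μ.toMeasure)) {u} = ρ.toMeasure {u} := by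
        rw [h2]
      rwa [withDensity_apply _ (measurableSet_singleton u), lintegral_singleton,
        PMF.toMeasure_apply_singleton _ _ (measurableSet_singleton u),
        PMF.toMeasure_apply_singleton _ _ (measurableSet_singleton u)] at h3
    rw [smul_eq_mul, llr, ← h1, ENNReal.toReal_mul, mul_div_cancel_right₀ _
      (ENNReal.toReal_ne_zero.2 ⟨hu, μ.apply_ne_top u⟩)]

theorem mem_klBall_iff {ρ μ : PMF U} {δ : ℝ} (hδ : 0 ≤ δ) :
    ρ ∈ klBall μ δ ↔ (∀ u, μ u = 0 → ρ u = 0) ∧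
      ∑ u, (ρ u).toReal * Real.log ((ρ u).toReal / (μ u).toReal) ≤ δ := by
  rw [klBall, Set.mem_ofPred_eq]
  constructor
  · intro h
    have hac : ∀ u, μ u = 0 → ρ u = 0 := by
      rw [← toMeasure_absolutelyContinuous_iff]
      by_contra hac
      rw [InformationTheory.klDiv_of_not_ac hac] at h
      exact ENNReal.ofReal_ne_top (top_le_iff.1 h)
    refine ⟨hac, ?_⟩
    rw [← (toReal_klDiv_eq_sum ρ μ hac).2]
    exact ENNReal.toReal_le_of_le_ofReal hδ h
  · rintro ⟨hac, h⟩
    obtain ⟨h1, h2⟩ := toReal_klDiv_eq_sum ρ μ hac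
    rw [← h2] at h
    exact (ENNReal.le_ofReal_iff_toReal_le h1 hδ).2 h

end KL

/-! ### Empirical dual value versus worst-case mean. -/

section Robust

variable {U : Type*} [Fintype U]

/-- The KL dual value of an empirical distribution, expanded around the true distribution. -/
theorem IsNormalized.empDual_expansion {m f : U → ℝ} {p : ℝ} (h : IsNormalized m f p) (hp : 0 < p)
    {δ θ : ℝ} (hδ : 0 < δ) (hδp : δ ≤ p / 32) (hθ : 0 < θ) (hθ1 : θ ≤ 1)
    (hθδ : tiltEntropy m f θ = δ) {n : ℕ} (hn : n ≠ 0) {x : Fin n → U} (hx : ∀ i, m (x i) ≠ 0)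
    {ξ : ℝ} (hξ0 : 0 ≤ ξ) (hξ : ∀ u, |empWeight x u - m u| ≤ ξ * m u) :
    |empDual x f δ - klDual m f δ θ| ≤ 6 * ξ ∧
    |empDual x f δ - klDual m f δ θ - ∑ u, (empWeight x u - m u) * tiltScore m f θ u| ≤
      2718 * ξ ^ 2 / p := by
  have hm := h.toIsWeight
  have hm' := isWeight_empWeight hn x
  have hlin := abs_sum_sub_mul_le hm (fun u hu => h.abs_tiltScore_le hθ hθ1 hu) hξ
  -- Lower bound, valid for every `ξ`: the true maximiser `θ` is a competitor in the empirical
  -- supremum.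
  have hlow := (hm.klDual_add_le hm' hθ δ (f := f)).trans (klDual_le_empDual hn x f hδ.le hθ)
  have hmem := empDual_mem hn x f hδ.le (fun i => (h.mem _ (hx i)).1) (fun i => (h.mem _ (hx i)).2)
  have hV : 0 ≤ klDual m f δ θ := by
    rw [hm.klDual_eq hθ hθδ]
    refine Finset.sum_nonneg fun u _ => ?_
    by_cases hu : m u = 0
    · simp [hu]
    · exact mul_nonneg (mul_nonneg (hm.nonneg u) (hm.tiltDensity_pos u).le) (h.mem u hu).1
  set s := ∑ u, (empWeight x u - m u) * tiltScore m f θ u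
  have hp1 : p ≤ 1 := by
    obtain ⟨a, _, hpa⟩ := h.exists_zero
    have := Finset.single_le_sum (fun u _ => hm.nonneg u) (Finset.mem_univ a)
    rw [hm.sum_eq_one] at this
    linarith
  rw [abs_le] at hlin
  have key : empDual x f δ ≤ klDual m f δ θ + 6 * ξ ∧
      empDual x f δ ≤ klDual m f δ θ + s + 2718 * ξ ^ 2 / p := by
    rcases le_total ξ (1 / 6) with h6 | h6
    -- The empirical law is normalised with `p/2`, and `δ ≤ p/32 = (p/2)/16`, so it has its own
    -- critical tilt `t ∈ (0,1]`. That tilt is feasible, hence by weak duality bounds the whole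
    -- supremum, including `α = 0`.
    · have h' := h.of_close hm' hξ (by linarith)
      obtain ⟨t, ht, ht1, htδ⟩ := h'.exists_tiltEntropy_eq (by linarith) hδ (by linarith)
      have hle : empDual x f δ ≤ klDual (empWeight x) f δ t := by
        rw [hm'.klDual_eq ht htδ]
        refine empDual_le_sum hn x f ⟨fun u => mul_nonneg (hm'.nonneg u)
          (hm'.tiltDensity_pos u).le, hm'.sum_mul_tiltDensity⟩ (fun u hu => by simp [hu])
          (le_of_eq ?_)
        rw [← htδ, tiltEntropy]
        refine Finset.sum_congr rfl fun u _ => ?_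
        by_cases hu : empWeight x u = 0
        · simp [hu]
        · rw [mul_div_cancel_left₀ _ hu, mul_assoc]
      have := h.klDual_expansion hp hm' hξ hξ0 h6 ht ht1 hθ hθ1 hθδ
      exact ⟨hle.trans this.1, hle.trans this.2⟩
    -- For `ξ ≥ 1/6` the trivial bounds `empDual ≤ 1` and `0 ≤ klDual` suffice: `1 ≤ 6ξ`, and `1 +
    -- 3ξ ≤ 36ξ² + 18ξ²`, where `3ξ` bounds the linear term.
    · have h1 : 54 * ξ ^ 2 ≤ 2718 * ξ ^ 2 / p := by
        rw [le_div_iff₀ hp]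
        nlinarith [sq_nonneg ξ]
      constructor
      · linarith
      · nlinarith
  have h0 : 0 ≤ 2718 * ξ ^ 2 / p := by positivity
  constructor <;> rw [abs_le] <;> constructor <;> linarith

theorem pmfMean_affine (ρ : PMF U) (y : U → ℝ) (c D : ℝ) :
    pmfMean ρ (fun u => c + D * y u) = c + D * pmfMean ρ y := by
  have h := ρ.isWeight.sum_eq_one
  simp only [pmfMean, mul_add, Finset.sum_add_distrib, ← Finset.sum_mul, h, one_mul,
    mul_left_comm _ D, ← Finset.mul_sum]

variable [MeasurableSpace U] [MeasurableSingletonClass U]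

/-- Strong duality: the worst-case mean over the KL ball is attained at a tilted distribution. -/
theorem IsNormalized.isLeast_klDual {μ : PMF U} {f : U → ℝ} {p : ℝ}
    (h : IsNormalized (fun u => (μ u).toReal) f p) {δ θ : ℝ} (hδ : 0 < δ) (hθ : 0 < θ)
    (hθδ : tiltEntropy (fun u => (μ u).toReal) f θ = δ) :
    IsLeast ((fun ρ => pmfMean ρ f) '' klBall μ δ) (klDual (fun u => (μ u).toReal) f δ θ) := by
  set m : U → ℝ := fun u => (μ u).toReal
  have hm : IsWeight m := h.toIsWeight
  constructor
  · have hnn : ∀ u, 0 ≤ m u * tiltDensity m f θ u := fun u =>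
      mul_nonneg (hm.nonneg u) (hm.tiltDensity_pos u).le
    let ρ : PMF U := PMF.ofFintype (fun u => ENNReal.ofReal (m u * tiltDensity m f θ u)) (by
      rw [← ENNReal.ofReal_sum_of_nonneg fun u _ => hnn u, hm.sum_mul_tiltDensity,
        ENNReal.ofReal_one])
    have hρ : ∀ u, (ρ u).toReal = m u * tiltDensity m f θ u := fun u =>
      ENNReal.toReal_ofReal (hnn u)
    refine ⟨ρ, (mem_klBall_iff hδ.le).2 ⟨fun u hu => ?_, le_of_eq ?_⟩, ?_⟩
    · have : m u = 0 := by simp [m, hu]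
      simp [ρ, this]
    · rw [← hθδ, tiltEntropy]
      refine Finset.sum_congr rfl fun u _ => ?_
      rw [hρ]
      by_cases hu : m u = 0
      · simp [hu]
      · rw [mul_div_cancel_left₀ _ hu, mul_assoc]
    · simp only [pmfMean, hρ]
      rw [hm.klDual_eq hθ hθδ]
  · rintro _ ⟨ρ, hρ, rfl⟩
    obtain ⟨h1, h2⟩ := (mem_klBall_iff hδ.le).1 hρ
    refine klDual_le_of_entropy_le hm ρ.isWeight (fun u hu => ?_) h2 hθ
    have : μ u = 0 := (ENNReal.toReal_eq_zero_iff _).1 hu |>.resolve_right (μ.apply_ne_top u)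
    simp [h1 u this]

/-- The empirical KL dual value is close to the worst-case mean `V`, with a linear leading error. -/
theorem exists_isLeast_empDual_expansion (μ : PMF U) {p : ℝ} (hp : 0 < p)
    (hμ : ∀ u, μ u ≠ 0 → p ≤ (μ u).toReal) {δ : ℝ} (hδ : 0 < δ) (hδp : δ ≤ p / 32) {f : U → ℝ}
    {lo B : ℝ} (hlo : ∀ u, lo ≤ f u) (hB : ∀ u, f u ≤ lo + B) :
    ∃ (V : ℝ) (l : U → ℝ), IsLeast ((fun ρ => pmfMean ρ f) '' klBall μ δ) V ∧
      ∀ (n : ℕ), n ≠ 0 → ∀ x : Fin n → U, (∀ i, μ (x i) ≠ 0) → ∀ ξ, 0 ≤ ξ →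
        (∀ u, |empWeight x u - (μ u).toReal| ≤ ξ * (μ u).toReal) →
        |empDual x f δ - V| ≤ B * (6 * ξ) ∧
        |empDual x f δ - V - ∑ u, (empWeight x u - (μ u).toReal) * l u| ≤
          B * (2718 * ξ ^ 2 / p) := by
  classical
  have hne : (Finset.univ.filter fun u => μ u ≠ 0).Nonempty := by
    obtain ⟨u, hu⟩ := μ.support_nonempty
    exact ⟨u, by simpa using hu⟩
  obtain ⟨a, ha, hamin⟩ := Finset.exists_min_image _ f hne
  obtain ⟨b, hb, hbmax⟩ := Finset.exists_max_image _ f hne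
  simp only [Finset.mem_filter, Finset.mem_univ, true_and] at ha hb hamin hbmax
  have hB0 : 0 ≤ B := by linarith [hlo a, hB a]
  rcases (hamin b hb).eq_or_lt with hab | hab
  · have hconst : ∀ u, μ u ≠ 0 → f u = f a := fun u hu =>
      le_antisymm (hab ▸ hbmax u hu) (hamin u hu)
    have hmean : ∀ ρ ∈ klBall μ δ, pmfMean ρ f = f a := fun ρ hρ => by
      have h1 := ((mem_klBall_iff hδ.le).1 hρ).1
      have h2 := ρ.isWeight.sum_eq_one
      rw [pmfMean, ← one_mul (f a), ← h2, Finset.sum_mul]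
      refine Finset.sum_congr rfl fun u _ => ?_
      by_cases hu : μ u = 0
      · simp [h1 u hu]
      · rw [hconst u hu]
    -- A payoff constant on the support cannot be normalised, but its dual value is exact, so the
    -- linear term is zero.
    refine ⟨f a, 0, ⟨⟨μ, self_mem_klBall μ δ, hmean μ (self_mem_klBall μ δ)⟩, ?_⟩, ?_⟩
    · rintro _ ⟨ρ, hρ, rfl⟩
      exact (hmean ρ hρ).ge
    · intro n hn x hx ξ hξ0 _
      have := empDual_mem hn x f hδ.le (lo := f a) (hi := f a) (fun i => (hconst _ (hx i)).ge)
        (fun i => (hconst _ (hx i)).le)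
      have h0 : empDual x f δ - f a = 0 := by linarith [this.1, this.2]
      simp only [h0, Pi.zero_apply, mul_zero, Finset.sum_const_zero, sub_zero, abs_zero]
      constructor <;> positivity
  · set D := f b - f a with hD
    have hD0 : 0 < D := sub_pos.2 hab
    have hDB : D ≤ B := by linarith [hlo a, hB b]
    -- The extremes are taken over the support only, so both are attained with mass at least `p`;
    -- off the support `y` may leave `[0,1]`.
    set y : U → ℝ := fun u => (f u - f a) / D with hy
    have hfy : f = fun u => f a + D * y u := by
      funext u
      rw [hy]
      field_simp
      ring
    set m : U → ℝ := fun u => (μ u).toReal with hm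
    have hmμ : ∀ u, m u ≠ 0 → μ u ≠ 0 := fun u hu h => hu (by simp [hm, h])
    have hN : IsNormalized m y p := by
      refine ⟨μ.isWeight, fun u hu => ⟨?_, ?_⟩, ⟨a, ?_, hμ a ha⟩, ⟨b, ?_, hμ b hb⟩⟩
      · exact div_nonneg (sub_nonneg.2 (hamin u (hmμ u hu))) hD0.le
      · rw [hy, div_le_one hD0]
        linarith [hbmax u (hmμ u hu)]
      · simp [hy]
      · exact div_self hD0.ne'
    obtain ⟨θ, hθ, hθ1, hθδ⟩ := hN.exists_tiltEntropy_eq hp.le hδ (by linarith)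
    have hleast := hN.isLeast_klDual hδ hθ hθδ
    refine ⟨f a + D * klDual m y δ θ, fun u => D * tiltScore m y θ u, ⟨?_, ?_⟩, ?_⟩
    · obtain ⟨ρ, hρ, h⟩ := hleast.1
      refine ⟨ρ, hρ, ?_⟩
      change pmfMean ρ f = _
      conv_lhs => rw [hfy, pmfMean_affine]
      exact congrArg (fun z => f a + D * z) h
    · rintro _ ⟨ρ, hρ, rfl⟩
      have := hleast.2 ⟨ρ, hρ, rfl⟩
      simp only at this ⊢
      conv_rhs => rw [hfy, pmfMean_affine]
      gcongr
    · intro n hn x hx ξ hξ0 hξ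
      have hx' : ∀ i, m (x i) ≠ 0 := fun i =>
        ENNReal.toReal_ne_zero.2 ⟨hx i, μ.apply_ne_top _⟩
      obtain ⟨h1, h2⟩ := hN.empDual_expansion hp hδ hδp hθ hθ1 hθδ hn hx' hξ0 hξ
      have e : empDual x f δ = f a + D * empDual x y δ := by
        conv_lhs => rw [hfy]
        exact empDual_affine hn x y _ hδ.le hD0
      have e1 : empDual x f δ - (f a + D * klDual m y δ θ) =
          D * (empDual x y δ - klDual m y δ θ) := by rw [e]; ring
      have e2 : ∑ u, (empWeight x u - m u) * (D * tiltScore m y θ u) =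
          D * ∑ u, (empWeight x u - m u) * tiltScore m y θ u := by
        rw [Finset.mul_sum]
        exact Finset.sum_congr rfl fun u _ => by ring
      rw [e1]
      constructor
      · rw [abs_mul, abs_of_pos hD0]
        exact mul_le_mul hDB h1 (abs_nonneg _) hB0
      · change |_ - ∑ u, (empWeight x u - m u) * (D * tiltScore m y θ u)| ≤ _
        rw [e2, ← mul_sub, abs_mul, abs_of_pos hD0]
        exact mul_le_mul hDB h2 (abs_nonneg _) hB0

end Robust

/-! ### Moments of empirical frequencies and of the empirical dual value. -/

section Sampling

/-- Batches take finitely many values, so every statistic of a batch, suprema over `α` included, is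
integrable with no further argument. -/
theorem integrable_comp_of_finite {Ω V : Type*} [MeasurableSpace Ω] {P : Measure Ω}
    [IsFiniteMeasure P] [Finite V] [MeasurableSpace V] [MeasurableSingletonClass V]
    {Y : Ω → V} (hY : Measurable Y) (g : V → ℝ) : Integrable (fun ω => g (Y ω)) P :=
  (Integrable.of_finite (μ := P.map Y)).comp_measurable hY

variable {Ω U : Type*} [MeasurableSpace Ω] {P : Measure Ω} [IsProbabilityMeasure P]
  [Fintype U] [MeasurableSpace U] [MeasurableSingletonClass U]
  {n : ℕ} {Y : Fin n → Ω → U} {μ : PMF U}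

omit [IsProbabilityMeasure P] in
theorem integral_indicator_law (hY : ∀ i, Measurable (Y i)) (hlaw : ∀ i, P.map (Y i) = μ.toMeasure)
    (i : Fin n) (u : U) :
    ∫ ω, Set.indicator {u} (1 : U → ℝ) (Y i ω) ∂P = (μ u).toReal := by
  have h : ∫ ω, Set.indicator {u} (1 : U → ℝ) (Y i ω) ∂P =
      ∫ v, Set.indicator {u} (1 : U → ℝ) v ∂(P.map (Y i)) :=
    (integral_map (hY i).aemeasurable
      (Measurable.of_discrete (f := Set.indicator {u} (1 : U → ℝ))).aestronglyMeasurable).symm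
  rw [h, hlaw, integral_indicator_one (measurableSet_singleton u), measureReal_def,
    PMF.toMeasure_apply_singleton _ _ (measurableSet_singleton u)]

theorem integral_empWeight (hn : n ≠ 0) (hY : ∀ i, Measurable (Y i))
    (hlaw : ∀ i, P.map (Y i) = μ.toMeasure) (u : U) :
    ∫ ω, empWeight (fun i => Y i ω) u ∂P = (μ u).toReal := by
  simp only [empWeight]
  rw [integral_div, integral_finsetSum _ fun i _ => integrable_comp_of_finite (hY i) _]
  simp only [integral_indicator_law hY hlaw, Finset.sum_const, Finset.card_univ, Fintype.card_fin,
    nsmul_eq_mul]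
  have : (n : ℝ) ≠ 0 := by exact_mod_cast hn
  field_simp

theorem integral_sq_empWeight_sub_le (hn : n ≠ 0) (hY : ∀ i, Measurable (Y i))
    (hlaw : ∀ i, P.map (Y i) = μ.toMeasure) (hind : iIndepFun Y P) (u : U) :
    ∫ ω, (empWeight (fun i => Y i ω) u - (μ u).toReal) ^ 2 ∂P ≤ (μ u).toReal / n := by
  have hn' : (0 : ℝ) < n := by exact_mod_cast Nat.pos_of_ne_zero hn
  set Z : Fin n → Ω → ℝ := fun i ω => Set.indicator {u} (1 : U → ℝ) (Y i ω) with hZ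
  have hZm : ∀ i, Measurable (Z i) := fun i =>
    (Measurable.of_discrete (f := Set.indicator {u} (1 : U → ℝ))).comp (hY i)
  have hZ2 : ∀ i, MemLp (Z i) 2 P := fun i =>
    (memLp_two_iff_integrable_sq (hZm i).aestronglyMeasurable).2
      (integrable_comp_of_finite (hY i) fun v => (Set.indicator {u} (1 : U → ℝ) v) ^ 2)
  have hvar : variance (∑ i, Z i) P = ∑ i, variance (Z i) P :=
    IndepFun.variance_sum (fun i _ => hZ2 i) fun i _ j _ hij =>
      (hind.indepFun hij).comp (φ := Set.indicator {u} (1 : U → ℝ))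
        (ψ := Set.indicator {u} (1 : U → ℝ)) Measurable.of_discrete Measurable.of_discrete
  have hvi : ∀ i, variance (Z i) P ≤ (μ u).toReal := fun i => by
    refine (variance_le_expectation_sq (hZm i).aestronglyMeasurable).trans (le_of_eq ?_)
    rw [← integral_indicator_law hY hlaw i u]
    refine integral_congr_ae (Filter.Eventually.of_forall fun ω => ?_)
    by_cases h : Y i ω = u <;> simp [hZ, h]
  have hmean := integral_empWeight hn hY hlaw (P := P) u
  have hemp : (fun ω => empWeight (fun i => Y i ω) u) = fun ω => (n : ℝ)⁻¹ * (∑ i, Z i) ω := by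
    funext ω
    simp only [empWeight, Finset.sum_apply, hZ]
    ring
  have hsm : Measurable fun ω => empWeight (fun i => Y i ω) u := by
    rw [hemp]
    simp only [Finset.sum_apply]
    exact (Finset.measurable_sum _ fun i _ => hZm i).const_mul _
  calc ∫ ω, (empWeight (fun i => Y i ω) u - (μ u).toReal) ^ 2 ∂P
      = variance (fun ω => empWeight (fun i => Y i ω) u) P := by
        rw [variance_eq_integral hsm.aemeasurable, hmean]
    _ = (n : ℝ)⁻¹ ^ 2 * ∑ i, variance (Z i) P := by rw [hemp, variance_const_mul, hvar]
    _ ≤ (n : ℝ)⁻¹ ^ 2 * ∑ _i : Fin n, (μ u).toReal := by gcongr with i; exact hvi i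
    _ = (μ u).toReal / n := by
        simp only [Finset.sum_const, Finset.card_univ, Fintype.card_fin, nsmul_eq_mul]
        field_simp

omit [IsProbabilityMeasure P] in
theorem ae_forall_ne_zero (hY : ∀ i, Measurable (Y i)) (hlaw : ∀ i, P.map (Y i) = μ.toMeasure) :
    ∀ᵐ ω ∂P, ∀ i, μ (Y i ω) ≠ 0 := by
  rw [ae_all_iff]
  intro i
  have h : ∀ᵐ v ∂(P.map (Y i)), μ v ≠ 0 := by
    rw [hlaw, ae_iff, PMF.toMeasure_apply_eq_zero_iff _ (Set.toFinite _).measurableSet,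
      Set.disjoint_left]
    intro v hv hv'
    exact hv' hv
  exact ae_of_ae_map (hY i).aemeasurable h

/-- The squared relative deviation of the empirical frequencies. -/
noncomputable def relDev (μ : PMF U) (x : Fin n → U) : ℝ :=
  ∑ u, ((empWeight x u - (μ u).toReal) / (μ u).toReal) ^ 2

omit [MeasurableSpace U] [MeasurableSingletonClass U] in
theorem relDev_nonneg (x : Fin n → U) : 0 ≤ relDev μ x :=
  Finset.sum_nonneg fun _ _ => sq_nonneg _

omit [MeasurableSpace U] [MeasurableSingletonClass U] in
theorem abs_empWeight_sub_le {x : Fin n → U} (hx : ∀ i, μ (x i) ≠ 0) (u : U) :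
    |empWeight x u - (μ u).toReal| ≤ √(relDev μ x) * (μ u).toReal := by
  by_cases hu : μ u = 0
  · have : empWeight x u = 0 := by
      by_contra h
      obtain ⟨i, rfl⟩ := exists_of_empWeight_ne_zero h
      exact hx i hu
    simp [this, hu]
  · have hpos : 0 < (μ u).toReal := ENNReal.toReal_pos hu (μ.apply_ne_top u)
    rw [← div_le_iff₀ hpos]
    refine Real.le_sqrt_of_sq_le ?_
    have h := Finset.single_le_sum (fun v _ => sq_nonneg
      ((empWeight x v - (μ v).toReal) / (μ v).toReal)) (Finset.mem_univ u)
    refine le_trans (le_of_eq ?_) h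
    rw [div_pow, sq_abs, div_pow]

/-- The term at `u` has mean at most `1/(n μ(u)) ≤ μ(u)/(n p²)`; as the `μ(u)` sum to one, no factor
of the cardinality appears. Off the support the terms vanish because division by zero gives zero. -/
theorem integral_relDev_le (hn : n ≠ 0) (hY : ∀ i, Measurable (Y i))
    (hlaw : ∀ i, P.map (Y i) = μ.toMeasure) (hind : iIndepFun Y P) {p : ℝ} (hp : 0 < p)
    (hμ : ∀ u, μ u ≠ 0 → p ≤ (μ u).toReal) :
    ∫ ω, relDev μ (fun i => Y i ω) ∂P ≤ 1 / (n * p ^ 2) := by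
  have hn' : (0 : ℝ) < n := by exact_mod_cast Nat.pos_of_ne_zero hn
  have hYm : Measurable fun ω i => Y i ω := measurable_pi_lambda _ hY
  simp only [relDev]
  rw [integral_finsetSum _ fun u _ => integrable_comp_of_finite hYm
    fun x => ((empWeight x u - (μ u).toReal) / (μ u).toReal) ^ 2]
  calc ∑ u, ∫ ω, ((empWeight (fun i => Y i ω) u - (μ u).toReal) / (μ u).toReal) ^ 2 ∂P
      ≤ ∑ u, (μ u).toReal * (1 / (n * p ^ 2)) := by
        refine Finset.sum_le_sum fun u _ => ?_
        simp only [div_pow]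
        rw [integral_div]
        by_cases hu : μ u = 0
        · simp [hu]
        · have h1 := hμ u hu
          have hpos : 0 < (μ u).toReal := by linarith
          rw [div_le_iff₀ (by positivity)]
          refine (integral_sq_empWeight_sub_le hn hY hlaw hind u).trans ?_
          have h2 : p ^ 2 ≤ (μ u).toReal ^ 2 := by gcongr
          rw [div_le_iff₀ hn']
          calc (μ u).toReal = (μ u).toReal * (p ^ 2 / p ^ 2) := by rw [div_self (by positivity), mul_one]
            _ ≤ (μ u).toReal * ((μ u).toReal ^ 2 / p ^ 2) := by gcongr
            _ = _ := by field_simp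
    _ = 1 / (n * p ^ 2) := by
        have h := μ.isWeight.sum_eq_one
        rw [← Finset.sum_mul, h, one_mul]

/-- Mean square error and bias of the empirical KL dual value. -/
theorem exists_isLeast_empDual_moments (μ : PMF U) {p : ℝ} (hp : 0 < p)
    (hμ : ∀ u, μ u ≠ 0 → p ≤ (μ u).toReal) {δ : ℝ} (hδ : 0 < δ) (hδp : δ ≤ p / 32) {f : U → ℝ}
    {lo B : ℝ} (hB0 : 0 ≤ B) (hlo : ∀ u, lo ≤ f u) (hB : ∀ u, f u ≤ lo + B)
    (hn : n ≠ 0) (hY : ∀ i, Measurable (Y i))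
    (hlaw : ∀ i, P.map (Y i) = μ.toMeasure) (hind : iIndepFun Y P) :
    ∃ V : ℝ, IsLeast ((fun ρ => pmfMean ρ f) '' klBall μ δ) V ∧
      ∫ ω, (empDual (fun i => Y i ω) f δ - V) ^ 2 ∂P ≤ 36 * B ^ 2 / (n * p ^ 2) ∧
      |∫ ω, (empDual (fun i => Y i ω) f δ - V) ∂P| ≤ 2718 * B / (n * p ^ 3) := by
  obtain ⟨V, l, hV, hexp⟩ := exists_isLeast_empDual_expansion μ hp hμ hδ hδp hlo hB
  refine ⟨V, hV, ?_⟩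
  have hYm : Measurable fun ω i => Y i ω := measurable_pi_lambda _ hY
  have hint : ∀ g : (Fin n → U) → ℝ, Integrable (fun ω => g fun i => Y i ω) P := fun g =>
    integrable_comp_of_finite hYm g
  have hrel := integral_relDev_le hn hY hlaw hind hp hμ
  have hae : ∀ᵐ ω ∂P, |empDual (fun i => Y i ω) f δ - V| ≤ B * (6 * √(relDev μ fun i => Y i ω)) ∧
      |empDual (fun i => Y i ω) f δ - V -
        ∑ u, (empWeight (fun i => Y i ω) u - (μ u).toReal) * l u| ≤
          B * (2718 * (relDev μ fun i => Y i ω) / p) := by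
    filter_upwards [ae_forall_ne_zero hY hlaw] with ω hω
    have h := hexp n hn (fun i => Y i ω) hω _ (Real.sqrt_nonneg _) (abs_empWeight_sub_le hω)
    rwa [Real.sq_sqrt (relDev_nonneg _)] at h
  constructor
  · calc ∫ ω, (empDual (fun i => Y i ω) f δ - V) ^ 2 ∂P
        ≤ ∫ ω, 36 * B ^ 2 * relDev μ (fun i => Y i ω) ∂P := by
          refine integral_mono_ae (hint fun x => (empDual x f δ - V) ^ 2)
            (hint fun x => 36 * B ^ 2 * relDev μ x) ?_
          filter_upwards [hae] with ω hω
          have h0 := relDev_nonneg (μ := μ) fun i => Y i ω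
          calc (empDual (fun i => Y i ω) f δ - V) ^ 2
              = |empDual (fun i => Y i ω) f δ - V| ^ 2 := (sq_abs _).symm
            _ ≤ (B * (6 * √(relDev μ fun i => Y i ω))) ^ 2 := by gcongr; exact hω.1
            _ = 36 * B ^ 2 * relDev μ (fun i => Y i ω) := by
                rw [mul_pow, mul_pow, Real.sq_sqrt h0]; ring
      _ ≤ 36 * B ^ 2 * (1 / (n * p ^ 2)) := by
          rw [integral_const_mul]
          gcongr
      _ = _ := by ring
  -- The leading error is linear in unbiased frequencies, so only the quadratic remainder
  -- contributes to the bias.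
  · have hlin : ∫ ω, ∑ u, (empWeight (fun i => Y i ω) u - (μ u).toReal) * l u ∂P = 0 := by
      rw [integral_finsetSum _ fun u _ => hint fun x => (empWeight x u - (μ u).toReal) * l u]
      refine Finset.sum_eq_zero fun u _ => ?_
      rw [integral_mul_const, integral_sub (hint fun x => empWeight x u) (integrable_const _),
        integral_empWeight hn hY hlaw]
      simp
    have e : ∫ ω, (empDual (fun i => Y i ω) f δ - V) ∂P =
        ∫ ω, (empDual (fun i => Y i ω) f δ - V -
          ∑ u, (empWeight (fun i => Y i ω) u - (μ u).toReal) * l u) ∂P := by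
      rw [integral_sub (hint fun x => empDual x f δ - V)
        (hint fun x => ∑ u, (empWeight x u - (μ u).toReal) * l u), hlin, sub_zero]
    rw [e]
    calc _ ≤ ∫ ω, |empDual (fun i => Y i ω) f δ - V -
          ∑ u, (empWeight (fun i => Y i ω) u - (μ u).toReal) * l u| ∂P :=
          abs_integral_le_integral_abs
      _ ≤ ∫ ω, B * 2718 / p * relDev μ (fun i => Y i ω) ∂P := by
          refine integral_mono_ae (hint fun x => |empDual x f δ - V -
            ∑ u, (empWeight x u - (μ u).toReal) * l u|)
            (hint fun x => B * 2718 / p * relDev μ x) ?_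
          filter_upwards [hae] with ω hω
          exact hω.2.trans (le_of_eq (by ring))
      _ ≤ B * 2718 / p * (1 / (n * p ^ 2)) := by
          rw [integral_const_mul]
          gcongr
      _ = _ := by field_simp

end Sampling

/-! ### The stepsize recursion as a weighted sum. -/

section Averaging

/-- The recursion `P_{k+1} = (1 - a_{k+1}) P_k + a_{k+1} w_{k+1}` started at zero. -/
noncomputable def stepAvg (a w : ℕ → ℝ) : ℕ → ℝ
  | 0 => 0
  | k + 1 => (1 - a (k + 1)) * stepAvg a w k + a (k + 1) * w (k + 1)

/-- The hypothesis `ha` keeps the latest weight an upper bound for all the others. With total mass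
at most one this controls the sum of squares, inductively by `(1 - a')² a + a'² ≤ (1 - a') a' + a'²
= a'`. The recursion never uses `w 0`, whose weight is zero. -/
theorem exists_stepAvg_eq_sum {a : ℕ → ℝ} (ha0 : ∀ k, 0 ≤ a k) (ha1 : ∀ k, a k ≤ 1)
    (ha : ∀ k, (1 - a (k + 1)) * a k ≤ a (k + 1)) (k : ℕ) :
    ∃ c : ℕ → ℝ, (∀ j, 0 ≤ c j) ∧ (∀ j, c j ≤ a k) ∧
      ∑ j ∈ Finset.range (k + 1), c j ≤ 1 ∧ ∑ j ∈ Finset.range (k + 1), c j ^ 2 ≤ a k ∧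
      ∀ w, stepAvg a w k = ∑ j ∈ Finset.range (k + 1), c j * w j := by
  induction k with
  | zero => exact ⟨0, by simp, by simp [ha0 0], by simp, by simp [ha0 0], by simp [stepAvg]⟩
  | succ k ih =>
    obtain ⟨c, h0, h1, h2, h3, h4⟩ := ih
    have hq : 0 ≤ 1 - a (k + 1) := sub_nonneg.2 (ha1 _)
    have hlt : ∀ {j}, j ∈ Finset.range (k + 1) → j ≠ k + 1 := fun {j} hj =>
      (Finset.mem_range.1 hj).ne
    refine ⟨fun j => if j = k + 1 then a (k + 1) else (1 - a (k + 1)) * c j, fun j => ?_,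
      fun j => ?_, ?_, ?_, fun w => ?_⟩
    · dsimp only
      split_ifs
      · exact ha0 _
      · exact mul_nonneg hq (h0 j)
    · dsimp only
      split_ifs
      · exact le_rfl
      · exact (mul_le_mul_of_nonneg_left (h1 j) hq).trans (ha k)
    · rw [Finset.sum_range_succ, if_pos rfl,
        Finset.sum_congr rfl fun j hj => if_neg (hlt hj), ← Finset.mul_sum]
      nlinarith
    · dsimp only
      rw [Finset.sum_range_succ, if_pos rfl,
        Finset.sum_congr rfl fun j hj => by rw [if_neg (hlt hj), mul_pow], ← Finset.mul_sum]
      have e1 := mul_le_mul_of_nonneg_left h3 (sq_nonneg (1 - a (k + 1)))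
      have e2 := mul_le_mul_of_nonneg_left (ha k) hq
      nlinarith
    · dsimp only
      rw [Finset.sum_range_succ, if_pos rfl, stepAvg, h4, Finset.mul_sum]
      congr 1
      exact Finset.sum_congr rfl fun j hj => by rw [if_neg (hlt hj), mul_assoc]

end Averaging

/-! ### Bernstein's inequality for the averaged noise. -/

section Bernstein

variable {Ω : Type*} [MeasurableSpace Ω] {P : Measure Ω} [IsProbabilityMeasure P]

theorem integrable_of_abs_le {X : Ω → ℝ} (hX : Measurable X) {M : ℝ} (hM : ∀ ω, |X ω| ≤ M) :
    Integrable X P :=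
  Integrable.of_bound hX.aestronglyMeasurable M (Filter.Eventually.of_forall hM)

theorem integrable_exp_of_abs_le {X : Ω → ℝ} (hX : Measurable X) {M : ℝ} (hM : ∀ ω, |X ω| ≤ M)
    (t : ℝ) : Integrable (fun ω => Real.exp (t * X ω)) P := by
  refine integrable_of_abs_le (M := Real.exp (|t| * M)) (hX.const_mul t).exp fun ω => ?_
  rw [abs_of_pos (Real.exp_pos _), Real.exp_le_exp]
  calc t * X ω ≤ |t * X ω| := le_abs_self _
    _ = |t| * |X ω| := abs_mul _ _
    _ ≤ |t| * M := by gcongr; exact hM ω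

/-- Integrate `e^x ≤ 1 + x + x²`, valid for `|x| ≤ 1`. -/
theorem mgf_le_exp_sq {X : Ω → ℝ} (hX : Measurable X) {M s t : ℝ} (hM : ∀ ω, |X ω| ≤ M)
    (h0 : ∫ ω, X ω ∂P = 0) (hs : ∫ ω, X ω ^ 2 ∂P ≤ s ^ 2) (ht : |t| * M ≤ 1) :
    mgf X P t ≤ Real.exp (t ^ 2 * s ^ 2) := by
  have hint := integrable_of_abs_le hX hM (P := P)
  have hint2 : Integrable (fun ω => X ω ^ 2) P := by
    refine integrable_of_abs_le (M := M ^ 2) (hX.pow_const 2) fun ω => ?_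
    rw [abs_pow]
    exact pow_le_pow_left₀ (abs_nonneg _) (hM ω) 2
  calc mgf X P t ≤ ∫ ω, (1 + t * X ω + t ^ 2 * X ω ^ 2) ∂P := by
        refine integral_mono (integrable_exp_of_abs_le hX hM t)
          (((integrable_const _).add (hint.const_mul t)).add (hint2.const_mul _)) fun ω => ?_
        have h1 : |t * X ω| ≤ 1 := by
          rw [abs_mul]
          exact (mul_le_mul_of_nonneg_left (hM ω) (abs_nonneg t)).trans ht
        have h2 := (abs_le.1 (Real.abs_exp_sub_one_sub_id_le h1)).2
        simp only [mul_pow] at h2 ⊢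
        linarith
    _ = 1 + t ^ 2 * ∫ ω, X ω ^ 2 ∂P := by
        have e : ∫ ω, (1 + t * X ω + t ^ 2 * X ω ^ 2) ∂P =
            ∫ ω, (1 + t * X ω) ∂P + ∫ ω, t ^ 2 * X ω ^ 2 ∂P :=
          integral_add ((integrable_const _).add (hint.const_mul t)) (hint2.const_mul _)
        rw [e, integral_add (integrable_const _) (hint.const_mul t), integral_const_mul,
          integral_const_mul, h0]
        simp
    _ ≤ 1 + t ^ 2 * s ^ 2 := by gcongr
    _ ≤ _ := by linarith [Real.add_one_le_exp (t ^ 2 * s ^ 2)]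

/-- One-sided Bernstein inequality for weighted sums of centred independent variables. -/
theorem measureReal_le_sum_le {Z : ℕ → Ω → ℝ} (hZ : ∀ j, Measurable (Z j)) (hind : iIndepFun Z P)
    {M s : ℝ} (hM0 : 0 < M) (hs0 : 0 < s) (hM : ∀ j ω, |Z j ω| ≤ M)
    (h0 : ∀ j, ∫ ω, Z j ω ∂P = 0) (hs : ∀ j, ∫ ω, Z j ω ^ 2 ∂P ≤ s ^ 2)
    {c : ℕ → ℝ} {a : ℝ} {k : ℕ} (ha : 0 < a) (hc0 : ∀ j, 0 ≤ c j) (hc1 : ∀ j, c j ≤ a)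
    (hc2 : ∑ j ∈ Finset.range k, c j ^ 2 ≤ a) {L : ℝ} (hL : 0 < L) :
    P.real {ω | 2 * s * √(a * L) + 2 * M * a * L ≤ ∑ j ∈ Finset.range k, c j * Z j ω} ≤
      Real.exp (-L) := by
  -- The Chernoff parameter is the smaller of `√(aL)/(sa)`, which makes the variance term equal to
  -- `L`, and `1/(Ma)`, the limit of validity of the moment bound.
  obtain ⟨t, ht0, ht1, ht2, ht3⟩ : ∃ t : ℝ, 0 ≤ t ∧ t * (M * a) ≤ 1 ∧ t ^ 2 * s ^ 2 * a ≤ L ∧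
      2 * L ≤ t * (2 * s * √(a * L) + 2 * M * a * L) := by
    have hsa : 0 < √(a * L) := Real.sqrt_pos.2 (by positivity)
    have hsq : √(a * L) ^ 2 = a * L := Real.sq_sqrt (by positivity)
    have e1 : √(a * L) / (s * a) * (2 * s * √(a * L)) = 2 * L := by
      field_simp
      rw [hsq]
    have e2 : 1 / (M * a) * (2 * M * a * L) = 2 * L := by field_simp
    have e3 : (√(a * L) / (s * a)) ^ 2 * s ^ 2 * a = L := by
      rw [div_pow, hsq]
      field_simp
    rcases le_total (√(a * L) / (s * a)) (1 / (M * a)) with h | h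
    · refine ⟨√(a * L) / (s * a), by positivity, ?_, e3.le, ?_⟩
      · rwa [le_div_iff₀ (by positivity)] at h
      · rw [mul_add, e1]
        have : 0 ≤ √(a * L) / (s * a) * (2 * M * a * L) := by positivity
        linarith
    · refine ⟨1 / (M * a), by positivity, by field_simp; rfl, ?_, ?_⟩
      · refine le_trans ?_ e3.le
        gcongr
      · rw [mul_add, e2]
        have : 0 ≤ 1 / (M * a) * (2 * s * √(a * L)) := by positivity
        linarith
  have hY : ∀ j, Measurable fun ω => c j * Z j ω := fun j => (hZ j).const_mul _
  have hindY : iIndepFun (fun j ω => c j * Z j ω) P :=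
    hind.comp (fun j x => c j * x) fun j => measurable_const_mul _
  have hS : Measurable fun ω => ∑ j ∈ Finset.range k, c j * Z j ω :=
    Finset.measurable_sum _ fun j _ => hY j
  have hSb : ∀ ω, |∑ j ∈ Finset.range k, c j * Z j ω| ≤ ∑ j ∈ Finset.range k, c j * M := fun ω =>
    (Finset.abs_sum_le_sum_abs _ _).trans <| Finset.sum_le_sum fun j _ => by
      rw [abs_mul, abs_of_nonneg (hc0 j)]
      exact mul_le_mul_of_nonneg_left (hM j ω) (hc0 j)
  refine (measure_ge_le_exp_mul_mgf _ ht0 (integrable_exp_of_abs_le hS hSb t)).trans ?_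
  have hmgf : mgf (fun ω => ∑ j ∈ Finset.range k, c j * Z j ω) P t ≤ Real.exp L := by
    have e : (fun ω => ∑ j ∈ Finset.range k, c j * Z j ω) =
        ∑ j ∈ Finset.range k, fun ω => c j * Z j ω := by
      funext ω
      simp
    rw [e, hindY.mgf_sum hY]
    calc ∏ j ∈ Finset.range k, mgf (fun ω => c j * Z j ω) P t
        ≤ ∏ j ∈ Finset.range k, Real.exp ((c j * t) ^ 2 * s ^ 2) := by
          refine Finset.prod_le_prod (fun j _ => mgf_nonneg) fun j _ => ?_
          rw [mgf_const_mul]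
          refine mgf_le_exp_sq (hZ j) (hM j) (h0 j) (hs j) ?_
          rw [abs_mul, abs_of_nonneg (hc0 j), abs_of_nonneg ht0]
          calc c j * t * M ≤ a * t * M := by gcongr; exact hc1 j
            _ ≤ 1 := by linarith
      _ = Real.exp (t ^ 2 * s ^ 2 * ∑ j ∈ Finset.range k, c j ^ 2) := by
          rw [← Real.exp_sum, Finset.mul_sum]
          congr 1
          exact Finset.sum_congr rfl fun j _ => by ring
      _ ≤ Real.exp L := by
          rw [Real.exp_le_exp]
          exact (mul_le_mul_of_nonneg_left hc2 (by positivity)).trans ht2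
  calc _ ≤ Real.exp (-t * (2 * s * √(a * L) + 2 * M * a * L)) * Real.exp L := by gcongr
    _ ≤ Real.exp (-L) := by
        rw [← Real.exp_add, Real.exp_le_exp]
        linarith

/-- Concentration of the averaged noise around its bias. -/
theorem measureReal_stepAvg_le {W : ℕ → Ω → ℝ} (hW : ∀ j, Measurable (W j)) (hind : iIndepFun W P)
    {M s b : ℝ} (hM0 : 0 < M) (hs0 : 0 < s) (hM : ∀ j ω, |W j ω| ≤ M)
    (hb : ∀ j, |∫ ω, W j ω ∂P| ≤ b) (hs : ∀ j, ∫ ω, W j ω ^ 2 ∂P ≤ s ^ 2)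
    {a : ℕ → ℝ} (ha0 : ∀ k, 0 < a k) (ha1 : ∀ k, a k ≤ 1)
    (ha : ∀ k, (1 - a (k + 1)) * a k ≤ a (k + 1)) (k : ℕ) {L : ℝ} (hL : 0 < L) :
    P.real {ω | b + (2 * s * √(a k * L) + 4 * M * a k * L) < |stepAvg a (fun j => W j ω) k|} ≤
      2 * Real.exp (-L) := by
  obtain ⟨c, hc0, hc1, hc, hc2, hsum⟩ := exists_stepAvg_eq_sum (fun k => (ha0 k).le) ha1 ha k
  set e : ℕ → ℝ := fun j => ∫ ω, W j ω ∂P with he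
  have hint : ∀ j, Integrable (W j) P := fun j => integrable_of_abs_le (hW j) (hM j)
  have hint2 : ∀ j, MemLp (W j) 2 P := fun j =>
    MemLp.of_bound (hW j).aestronglyMeasurable M (Filter.Eventually.of_forall (hM j))
  have heM : ∀ j, |e j| ≤ M := fun j => by
    have := norm_integral_le_of_norm_le_const (μ := P) (f := W j) (C := M) (Filter.Eventually.of_forall (hM j))
    simpa using this
  have hcen : ∀ j, ∫ ω, (W j ω - e j) ∂P = 0 := fun j => by
    rw [integral_sub (hint j) (integrable_const _)]
    simp [he]
  have hvar : ∀ j, ∫ ω, (W j ω - e j) ^ 2 ∂P ≤ s ^ 2 := fun j => by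
    rw [← variance_eq_integral (hW j).aemeasurable]
    exact (variance_le_expectation_sq (hW j).aestronglyMeasurable).trans (hs j)
  -- Centring may double the sup bound, which turns `2M` into `4M` in the deviation.
  have hup := measureReal_le_sum_le (Z := fun j ω => W j ω - e j) (M := 2 * M)
    (fun j => (hW j).sub_const _)
    (hind.comp (fun j x => x - e j) fun j => measurable_id.sub_const _) (by positivity) hs0
    (fun j ω => (abs_sub _ _).trans (by linarith [hM j ω, heM j])) hcen hvar (ha0 k) hc0 hc1 hc2 hL
  have hdown := measureReal_le_sum_le (Z := fun j ω => -(W j ω - e j)) (M := 2 * M)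
    (fun j => ((hW j).sub_const _).neg)
    (hind.comp (fun j x => -(x - e j)) fun j => (measurable_id.sub_const _).neg) (by positivity) hs0
    (fun j ω => by rw [abs_neg]; exact (abs_sub _ _).trans (by linarith [hM j ω, heM j]))
    (fun j => by rw [integral_neg, hcen, neg_zero]) (fun j => by simpa only [neg_sq] using hvar j)
    (ha0 k) hc0 hc1 hc2 hL
  have hbias : |∑ j ∈ Finset.range (k + 1), c j * e j| ≤ b := by
    have hb0 : 0 ≤ b := (abs_nonneg _).trans (hb 0)
    calc _ ≤ ∑ j ∈ Finset.range (k + 1), |c j * e j| := Finset.abs_sum_le_sum_abs _ _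
      _ ≤ ∑ j ∈ Finset.range (k + 1), c j * b := Finset.sum_le_sum fun j _ => by
          rw [abs_mul, abs_of_nonneg (hc0 j)]
          exact mul_le_mul_of_nonneg_left (hb j) (hc0 j)
      _ ≤ b := by
          rw [← Finset.sum_mul]
          exact mul_le_of_le_one_left hb0 hc
  refine le_trans ?_ (le_trans (add_le_add hup hdown) (two_mul _).ge)
  refine (measureReal_mono ?_).trans (measureReal_union_le _ _)
  intro ω hω
  rw [Set.mem_ofPred_eq, hsum] at hω
  have hdec : ∑ j ∈ Finset.range (k + 1), c j * W j ω =
      ∑ j ∈ Finset.range (k + 1), c j * (W j ω - e j) +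
        ∑ j ∈ Finset.range (k + 1), c j * e j := by
    rw [← Finset.sum_add_distrib]
    exact Finset.sum_congr rfl fun j _ => by ring
  have hneg : ∑ j ∈ Finset.range (k + 1), c j * -(W j ω - e j) =
      -∑ j ∈ Finset.range (k + 1), c j * (W j ω - e j) := by
    simp only [mul_neg, Finset.sum_neg_distrib]
  rw [hdec] at hω
  rw [Set.mem_union, Set.mem_ofPred_eq, Set.mem_ofPred_eq, hneg]
  have h1 := abs_add_le (∑ j ∈ Finset.range (k + 1), c j * (W j ω - e j))
    (∑ j ∈ Finset.range (k + 1), c j * e j)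
  have h2 : 2 * s * √(a k * L) + 2 * (2 * M) * a k * L <
      |∑ j ∈ Finset.range (k + 1), c j * (W j ω - e j)| := by linarith
  rcases lt_abs.1 h2 with h | h
  · exact Or.inl h.le
  · exact Or.inr h.le

end Bernstein

/-- Independence of the blocks of an independent family indexed by pairs. -/
theorem iIndepFun_blocks {Ω V ι κ : Type*} [MeasurableSpace Ω] {P : Measure Ω}
    [IsProbabilityMeasure P] [MeasurableSpace V] {X : ι → κ → Ω → V}
    (hX : ∀ i j, Measurable (X i j)) (h : iIndepFun (fun q : ι × κ => X q.1 q.2) P) :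
    iIndepFun (fun i ω j => X i j ω) P := by
  have h' : iIndepFun (fun q : (_ : ι) × κ => X q.1 q.2) P :=
    h.precomp (Equiv.sigmaEquivProd ι κ).injective
  have hp : ∀ i j, IsProbabilityMeasure (P.map (X i j)) := fun i j =>
    Measure.isProbabilityMeasure_map (hX i j).aemeasurable
  have hin : ∀ i, iIndepFun (X i) P := fun i =>
    h.precomp (g := fun j => (i, j)) fun _ _ hjj => (Prod.mk.inj hjj).2
  -- Independence means that the joint law is a product; currying turns a product over pairs into a
  -- product of products.
  have hcur : (MeasurableEquiv.piCurry fun (_ : ι) (_ : κ) => V) ∘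
      (fun ω (q : (_ : ι) × κ) => X q.1 q.2 ω) = fun ω i j => X i j ω := by
    ext; simp [Sigma.curry]
  rw [iIndepFun_iff_map_fun_eq_infinitePi_map (by fun_prop)] at h' ⊢
  rw [← hcur, ← Measure.map_map (by fun_prop) (by fun_prop), h',
    Measure.infinitePi_map_piCurry (fun i j => P.map (X i j))]
  congr 1
  funext i
  rw [(iIndepFun_iff_map_fun_eq_infinitePi_map (hX i)).1 (hin i)]

/-! ### Support probabilities, Bellman bounds and stepsizes. -/

namespace RobustMDP

variable {S : Type u} {A : Type v}

section SupportProb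

variable [Finite S] [Finite A] (M : RobustMDP S A)

theorem minSupportProb_le_min (s : S) (a : A) : M.minSupportProb ≤
    min (⨅ r : (M.rewardLaw s a).support, (M.rewardLaw s a r).toReal)
      (⨅ s' : (M.transition s a).support, (M.transition s a s').toReal) :=
  ciInf_le (Set.finite_range fun x : S × A =>
    min (⨅ r : (M.rewardLaw x.1 x.2).support, (M.rewardLaw x.1 x.2 r).toReal)
      (⨅ s' : (M.transition x.1 x.2).support, (M.transition x.1 x.2 s').toReal)).bddBelow (s, a)

theorem minSupportProb_le_rewardLaw (s : S) (a : A) (r : M.rewards) (hr : M.rewardLaw s a r ≠ 0) :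
    M.minSupportProb ≤ (M.rewardLaw s a r).toReal :=
  ((M.minSupportProb_le_min s a).trans (min_le_left _ _)).trans <|
    ciInf_le (f := fun r : (M.rewardLaw s a).support => (M.rewardLaw s a r).toReal)
      (Set.finite_range _).bddBelow ⟨r, hr⟩

theorem minSupportProb_le_transition (s : S) (a : A) (s' : S) (hs : M.transition s a s' ≠ 0) :
    M.minSupportProb ≤ (M.transition s a s').toReal :=
  ((M.minSupportProb_le_min s a).trans (min_le_right _ _)).trans <|
    ciInf_le (f := fun s' : (M.transition s a).support => (M.transition s a s').toReal)
      (Set.finite_range _).bddBelow ⟨s', hs⟩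

theorem iInf_support_pos {U : Type*} [Finite U] (μ : PMF U) :
    0 < ⨅ u : μ.support, (μ u).toReal := by
  have : Nonempty μ.support := μ.support_nonempty.to_subtype
  obtain ⟨u, hu⟩ := exists_eq_ciInf_of_finite (f := fun u : μ.support => (μ u).toReal)
  rw [← hu]
  exact ENNReal.toReal_pos u.2 (μ.apply_ne_top _)

variable [Nonempty S] [Nonempty A]

theorem minSupportProb_pos : 0 < M.minSupportProb := by
  obtain ⟨x, hx⟩ := exists_eq_ciInf_of_finite (f := fun x : S × A =>
    min (⨅ r : (M.rewardLaw x.1 x.2).support, (M.rewardLaw x.1 x.2 r).toReal)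
      (⨅ s' : (M.transition x.1 x.2).support, (M.transition x.1 x.2 s').toReal))
  rw [minSupportProb, ← hx]
  exact lt_min (iInf_support_pos _) (iInf_support_pos _)

theorem minSupportProb_le_one : M.minSupportProb ≤ 1 := by
  obtain ⟨s⟩ := ‹Nonempty S›
  obtain ⟨a⟩ := ‹Nonempty A›
  obtain ⟨s', hs'⟩ := (M.transition s a).support_nonempty
  refine (M.minSupportProb_le_transition s a s' hs').trans ?_
  exact ENNReal.toReal_le_of_le_ofReal zero_le_one (by simpa using (M.transition s a).coe_le_one s')

/-- From `-log (1 - y) ≤ (1 - y)⁻¹ - 1` at `y = p/48`, using `p ≤ 1`. The value `p/32` is what an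
empirical law with half the minimal mass needs. -/
theorem δ_le_of_lt_neg_log (hδ : M.δ < -Real.log (1 - M.minSupportProb / 48)) :
    M.δ ≤ M.minSupportProb / 32 := by
  have h0 := M.minSupportProb_pos
  have h1 := M.minSupportProb_le_one
  set p := M.minSupportProb
  have hy : 0 < 1 - p / 48 := by linarith
  have h2 := Real.one_sub_inv_le_log_of_pos hy
  have h3 : (1 - p / 48)⁻¹ ≤ 1 + p / 32 := by
    rw [inv_le_iff_one_le_mul₀ hy]
    nlinarith
  linarith

end SupportProb

section Bounds

variable [Fintype S] [MeasurableSpace S]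

theorem robustReturn_eq_add (M : RobustMDP S A) (v : S → ℝ) (s : S) (a : A) {V V' : ℝ}
    (hV : IsLeast ((fun ρ => pmfMean ρ (fun r : M.rewards => (r : ℝ))) ''
      klBall (M.rewardLaw s a) M.δ) V)
    (hV' : IsLeast ((fun ρ => pmfMean ρ v) '' klBall (M.transition s a) M.δ) V') :
    M.robustReturn v s a = V + M.γ * V' := by
  obtain ⟨ν, hν, hνV⟩ := hV.1
  obtain ⟨π, hπ, hπV⟩ := hV'.1
  apply le_antisymm
  · have := ciInf_le (M.robustReturn_bddBelow v s a) (⟨ν, hν⟩, ⟨π, hπ⟩)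
    simp only at this hνV hπV
    rwa [hνV, hπV] at this
  · have : Nonempty (klBall (M.rewardLaw s a) M.δ × klBall (M.transition s a) M.δ) :=
      ⟨⟨ν, hν⟩, ⟨π, hπ⟩⟩
    refine le_ciInf fun x => ?_
    exact add_le_add (hV.2 ⟨_, x.1.2, rfl⟩)
      (mul_le_mul_of_nonneg_left (hV'.2 ⟨_, x.2.2, rfl⟩) M.γ_pos.le)

theorem abs_robustReturn_le (M : RobustMDP S A) (hR : ∀ r ∈ M.rewards, r ≤ 1) (v : S → ℝ) (s : S)
    (a : A) : |M.robustReturn v s a| ≤ 1 + M.γ * ‖v‖ := by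
  have h : ∀ x : klBall (M.rewardLaw s a) M.δ × klBall (M.transition s a) M.δ,
      |pmfMean (x.1 : PMF M.rewards) (fun r => (r : ℝ)) + M.γ * pmfMean (x.2 : PMF S) v| ≤
        1 + M.γ * ‖v‖ := fun x => by
    have h1 := abs_pmfMean_le (x.1 : PMF M.rewards) (fun r => (r : ℝ)) 1 fun r => by
      rw [abs_of_nonneg (M.rewards_nonneg r r.2)]
      exact hR r r.2
    have h2 := abs_pmfMean_le (x.2 : PMF S) v _ (norm_le_pi_norm v)
    refine (abs_add_le _ _).trans (add_le_add h1 ?_)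
    rw [abs_mul, abs_of_pos M.γ_pos]
    exact mul_le_mul_of_nonneg_left h2 M.γ_pos.le
  have x : klBall (M.rewardLaw s a) M.δ × klBall (M.transition s a) M.δ :=
    ⟨⟨_, self_mem_klBall _ _⟩, ⟨_, self_mem_klBall _ _⟩⟩
  have : Nonempty (klBall (M.rewardLaw s a) M.δ × klBall (M.transition s a) M.δ) := ⟨x⟩
  rw [abs_le]
  exact ⟨le_ciInf fun y => (abs_le.1 (h y)).1,
    (ciInf_le (M.robustReturn_bddBelow v s a) x).trans (abs_le.1 (h x)).2⟩

variable [Finite A] [Nonempty A]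

/-- The Bellman equation itself; it makes the payoff in the noise the fixed function `optValue`. -/
theorem iSup_optQ (M : RobustMDP S A) (s : S) : ⨆ a, M.optQ s a = M.optValue s :=
  congrFun M.existsUnique_bellman_eq.choose_spec.1 s

theorem abs_ciSup_le {ι : Type*} [Finite ι] [Nonempty ι] {f : ι → ℝ} {C : ℝ} (h : ∀ i, |f i| ≤ C) :
    |⨆ i, f i| ≤ C := by
  obtain ⟨i, hi⟩ := exists_eq_ciSup_of_finite (f := f)
  rw [← hi]
  exact h i

theorem norm_optValue_le (M : RobustMDP S A) (hR : ∀ r ∈ M.rewards, r ≤ 1) :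
    ‖M.optValue‖ ≤ 1 / (1 - M.γ) := by
  have h0 : 0 < 1 - M.γ := sub_pos.2 M.γ_lt_one
  have h : ‖M.optValue‖ ≤ 1 + M.γ * ‖M.optValue‖ := by
    refine (pi_norm_le_iff_of_nonneg (by have := M.γ_pos; positivity)).2 fun s => ?_
    rw [← M.iSup_optQ s]
    exact abs_ciSup_le fun a => M.abs_robustReturn_le hR _ s a
  rw [le_div_iff₀ h0]
  linarith

theorem abs_optQ_le (M : RobustMDP S A) (hR : ∀ r ∈ M.rewards, r ≤ 1) (s : S) (a : A) :
    |M.optQ s a| ≤ 1 / (1 - M.γ) := by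
  have h0 : 0 < 1 - M.γ := sub_pos.2 M.γ_lt_one
  refine (M.abs_robustReturn_le hR _ s a).trans ?_
  calc 1 + M.γ * ‖M.optValue‖ ≤ 1 + M.γ * (1 / (1 - M.γ)) := by
        have := M.norm_optValue_le hR
        have := M.γ_pos
        gcongr
    _ = 1 / (1 - M.γ) := by field_simp; ring

omit [MeasurableSpace S] in
theorem abs_empBellman_sub_le (M : RobustMDP S A) {n : ℕ} (hn : n ≠ 0)
    (x : Fin n → S → A → M.rewards × S) {q q' : S → A → ℝ} {ε : ℝ}
    (h : ∀ s a, |q s a - q' s a| ≤ ε) (s : S) (a : A) :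
    |M.empBellman x q s a - M.empBellman x q' s a| ≤ M.γ * ε := by
  have aux : ∀ {q q' : S → A → ℝ}, (∀ s a, |q s a - q' s a| ≤ ε) →
      M.empBellman x q s a ≤ M.empBellman x q' s a + M.γ * ε := fun {q q'} h => by
    have h1 := empDual_le_add hn (fun i => (x i s a).2) (f := fun s' => ⨆ b, q s' b)
      (g := fun s' => ⨆ b, q' s' b) (ε := ε) M.δ_pos.le fun i => by
        refine ciSup_le fun b => ?_
        have h2 := le_ciSup (Set.finite_range (q' (x i s a).2)).bddAbove b
        linarith [(abs_le.1 (h (x i s a).2 b)).2]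
    have h2 := mul_le_mul_of_nonneg_left h1 M.γ_pos.le
    simp only [empBellman]
    linarith
  have h1 := aux h
  have h2 := aux (q := q') (q' := q) fun s a => by rw [abs_sub_comm]; exact h s a
  rw [abs_le]
  constructor <;> linarith

/-- The error of one application of the empirical Bellman operator at the optimal `q`-function. -/
noncomputable def bellmanNoise (M : RobustMDP S A) {n : ℕ} (x : Fin n → S → A → M.rewards × S)
    (s : S) (a : A) : ℝ := M.empBellman x M.optQ s a - M.optQ s a

theorem bellmanNoise_eq (M : RobustMDP S A) {n : ℕ} (x : Fin n → S → A → M.rewards × S) (s : S)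
    (a : A) {V V' : ℝ} (h : M.optQ s a = V + M.γ * V') : M.bellmanNoise x s a =
      (empDual (fun i => (x i s a).1) (fun r => (r : ℝ)) M.δ - V) +
        M.γ * (empDual (fun i => (x i s a).2) M.optValue M.δ - V') := by
  rw [bellmanNoise, empBellman, h]
  simp only [iSup_optQ]
  ring

theorem abs_bellmanNoise_le (M : RobustMDP S A) (hR : ∀ r ∈ M.rewards, r ≤ 1) {n : ℕ} (hn : n ≠ 0)
    (x : Fin n → S → A → M.rewards × S) (s : S) (a : A) :
    |M.bellmanNoise x s a| ≤ 2 / (1 - M.γ) := by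
  have h0 : 0 < 1 - M.γ := sub_pos.2 M.γ_lt_one
  have hq := M.abs_optQ_le hR s a
  have hv := fun s => abs_le.1 ((norm_le_pi_norm M.optValue s).trans (M.norm_optValue_le hR))
  have h1 := empDual_mem hn (fun i => (x i s a).1) (fun r => (r : ℝ)) M.δ_pos.le (lo := 0) (hi := 1)
    (fun i => M.rewards_nonneg _ (x i s a).1.2) (fun i => hR _ (x i s a).1.2)
  have h2 := empDual_mem hn (fun i => (x i s a).2) M.optValue M.δ_pos.le
    (fun i => (hv _).1) (fun i => (hv _).2)
  have h3 : |M.empBellman x M.optQ s a| ≤ 1 + M.γ * (1 / (1 - M.γ)) := by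
    rw [empBellman]
    simp only [iSup_optQ]
    refine (abs_add_le _ _).trans (add_le_add (abs_le.2 ⟨by linarith [h1.1], h1.2⟩) ?_)
    rw [abs_mul, abs_of_pos M.γ_pos]
    exact mul_le_mul_of_nonneg_left (abs_le.2 h2) M.γ_pos.le
  have h4 : 1 + M.γ * (1 / (1 - M.γ)) = 1 / (1 - M.γ) := by field_simp; ring
  rw [h4] at h3
  refine (abs_sub _ _).trans ((add_le_add h3 hq).trans (le_of_eq (by ring)))

end Bounds

section Stepsize

variable (M : RobustMDP S A)

theorem stepsize_zero : M.stepsize 0 = 1 := by simp [stepsize]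

theorem stepsize_pos (k : ℕ) : 0 < M.stepsize k := by
  have : 0 < 1 - M.γ := sub_pos.2 M.γ_lt_one
  unfold stepsize
  positivity

theorem stepsize_le_one (k : ℕ) : M.stepsize k ≤ 1 := by
  have : 0 < 1 - M.γ := sub_pos.2 M.γ_lt_one
  rw [stepsize, div_le_one (by positivity)]
  have : 0 ≤ (1 - M.γ) * (k : ℝ) := by positivity
  linarith

/-- The identity behind the choice of stepsize: the contraction factor of one update is exactly the
ratio of consecutive stepsizes. -/
theorem stepsize_succ (k : ℕ) :
    (1 - (1 - M.γ) * M.stepsize (k + 1)) * M.stepsize k = M.stepsize (k + 1) := by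
  have : 0 < 1 - M.γ := sub_pos.2 M.γ_lt_one
  have h1 : 0 < 1 + (1 - M.γ) * (k : ℝ) := by positivity
  have h2 : 0 < 1 + (1 - M.γ) * ((k : ℝ) + 1) := by positivity
  simp only [stepsize, Nat.cast_add, Nat.cast_one]
  field_simp
  ring

theorem one_sub_stepsize_mul_le (k : ℕ) :
    (1 - M.stepsize (k + 1)) * M.stepsize k ≤ M.stepsize (k + 1) := by
  conv_rhs => rw [← M.stepsize_succ k]
  refine mul_le_mul_of_nonneg_right ?_ (M.stepsize_pos k).le
  nlinarith [M.γ_pos, M.stepsize_pos (k + 1)]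

theorem stepsize_le (k : ℕ) : M.stepsize k ≤ 1 / ((1 - M.γ) * (k + 1)) := by
  have : 0 < 1 - M.γ := sub_pos.2 M.γ_lt_one
  rw [stepsize]
  refine one_div_le_one_div_of_le (by positivity) ?_
  nlinarith [M.γ_pos]

end Stepsize

/-! ### Error recursion of Q-learning. -/

section Recursion

variable [Fintype S] [MeasurableSpace S] [Finite A] [Nonempty A]

/-- The error of robust Q-learning in terms of bounds on the averaged noise. -/
theorem abs_drQ_sub_le (M : RobustMDP S A) (hR : ∀ r ∈ M.rewards, r ≤ 1) {n : ℕ} (hn : n ≠ 0)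
    (x : ℕ → Fin n → S → A → M.rewards × S) {β : ℕ → ℝ} {K : ℕ}
    (hβ : ∀ k < K, ∀ s a, |stepAvg M.stepsize (fun j => M.bellmanNoise (x j) s a) k| ≤ β k)
    (s : S) (a : A) :
    |M.drQ x K s a - M.optQ s a - stepAvg M.stepsize (fun j => M.bellmanNoise (x j) s a) K| ≤
      M.stepsize K * (1 / (1 - M.γ) + ∑ k ∈ Finset.range K, β k) := by
  induction K generalizing s a with
  | zero =>
    simpa [drQ, stepAvg, stepsize_zero] using M.abs_optQ_le hR s a
  | succ K ih =>
    have ih' := fun s a => ih (fun k hk => hβ k (by omega)) s a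
    set D := M.stepsize K * (1 / (1 - M.γ) + ∑ k ∈ Finset.range K, β k) with hD
    set l := M.stepsize (K + 1) with hl
    have hq : ∀ s a, |M.drQ x K s a - M.optQ s a| ≤ D + β K := fun s a => by
      have h1 := ih' s a
      have h2 := hβ K (by omega) s a
      have h3 := abs_add_le
        (M.drQ x K s a - M.optQ s a - stepAvg M.stepsize (fun j => M.bellmanNoise (x j) s a) K)
        (stepAvg M.stepsize (fun j => M.bellmanNoise (x j) s a) K)
      rw [sub_add_cancel] at h3
      linarith
    have hT := M.abs_empBellman_sub_le hn (x (K + 1)) hq s a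
    have hl0 : 0 < l := M.stepsize_pos _
    have hl1 : 0 ≤ 1 - l := sub_nonneg.2 (M.stepsize_le_one _)
    -- The same batch enters `q_{K+1}` and the averaged noise, so its error at `optQ` cancels and
    -- only a difference of one operator at two arguments remains.
    have e : M.drQ x (K + 1) s a - M.optQ s a -
        stepAvg M.stepsize (fun j => M.bellmanNoise (x j) s a) (K + 1) =
        (1 - l) * (M.drQ x K s a - M.optQ s a -
          stepAvg M.stepsize (fun j => M.bellmanNoise (x j) s a) K) +
        l * (M.empBellman (x (K + 1)) (M.drQ x K) s a -
          M.empBellman (x (K + 1)) M.optQ s a) := by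
      simp only [drQ, stepAvg, Pi.add_apply, Pi.smul_apply, smul_eq_mul, bellmanNoise, ← hl]
      ring
    have hβ0 : 0 ≤ β K := (abs_nonneg _).trans (hβ K (by omega) s a)
    rw [e]
    calc _ ≤ (1 - l) * D + l * (M.γ * (D + β K)) := by
          refine (abs_add_le _ _).trans (add_le_add ?_ ?_)
          · rw [abs_mul, abs_of_nonneg hl1]
            exact mul_le_mul_of_nonneg_left (ih' s a) hl1
          · rw [abs_mul, abs_of_pos hl0]
            exact mul_le_mul_of_nonneg_left hT hl0.le
      _ ≤ (1 - (1 - M.γ) * l) * D + l * β K := by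
          have : M.γ * (l * β K) ≤ l * β K :=
            mul_le_of_le_one_left (by positivity) M.γ_lt_one.le
          linarith
      _ = l * (1 / (1 - M.γ) + ∑ k ∈ Finset.range (K + 1), β k) := by
          rw [hD, ← mul_assoc, M.stepsize_succ, Finset.sum_range_succ]
          ring

end Recursion

end RobustMDP

namespace RobustMDP

/-! ### Moments and concentration of the Bellman noise. -/

section Noise

variable {S : Type u} {A : Type v} [Fintype S] [Finite A] [Nonempty S] [Nonempty A]
  [MeasurableSpace S] [DiscreteMeasurableSpace S]

/-- Second moment and bias of the noise of the empirical Bellman operator. -/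
theorem IsSampling.bellmanNoise_moments {M : RobustMDP S A}
    (hδ : M.δ ≤ M.minSupportProb / 32) (hR : ∀ r ∈ M.rewards, r ≤ 1) {n : ℕ} (hn : n ≠ 0)
    {Ω : Type w} [MeasurableSpace Ω] {P : Measure Ω} [IsProbabilityMeasure P]
    {X : ℕ → Fin n → Ω → S → A → M.rewards × S} (hX : M.IsSampling P X) (s : S) (a : A) (k : ℕ) :
    ∫ ω, M.bellmanNoise (fun i => X k i ω) s a ^ 2 ∂P ≤
      (20 / (M.minSupportProb * (1 - M.γ) * √n)) ^ 2 ∧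
    |∫ ω, M.bellmanNoise (fun i => X k i ω) s a ∂P| ≤
      8154 / (M.minSupportProb ^ 3 * (1 - M.γ) * n) := by
  have hp := M.minSupportProb_pos
  set p := M.minSupportProb
  have hκ : 0 < 1 - M.γ := sub_pos.2 M.γ_lt_one
  have hn' : (0 : ℝ) < n := by exact_mod_cast Nat.pos_of_ne_zero hn
  have : MeasurableSingletonClass (S → A → M.rewards × S) := inferInstance
  have : MeasurableSingletonClass (Fin n → S → A → M.rewards × S) :=
    Pi.instMeasurableSingletonClass
  have : DiscreteMeasurableSpace (S → A → M.rewards × S) :=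
    MeasurableSingletonClass.toDiscreteMeasurableSpace
  have hv := fun s => abs_le.1 ((norm_le_pi_norm M.optValue s).trans (M.norm_optValue_le hR))
  have hm1 : Measurable fun y : S → A → M.rewards × S => (y s a).1 := Measurable.of_discrete
  have hm2 : Measurable fun y : S → A → M.rewards × S => (y s a).2 := Measurable.of_discrete
  have hind : iIndepFun (X k) P :=
    hX.indep.precomp (g := fun i => (k, i)) fun _ _ h => (Prod.mk.inj h).2
  obtain ⟨V, hV, hV2, hV1⟩ := exists_isLeast_empDual_moments (M.rewardLaw s a) hp
    (M.minSupportProb_le_rewardLaw s a) M.δ_pos hδ (f := fun r => (r : ℝ)) (lo := 0) (B := 1)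
    zero_le_one (fun r => M.rewards_nonneg r r.2) (fun r => by linarith [hR r r.2]) hn
    (fun i => hm1.comp (hX.measurable k i)) (fun i => hX.reward_law k i s a)
    (hind.comp (fun _ y => (y s a).1) fun _ => hm1)
  obtain ⟨V', hV', hV2', hV1'⟩ := exists_isLeast_empDual_moments (M.transition s a) hp
    (M.minSupportProb_le_transition s a) M.δ_pos hδ (f := M.optValue) (lo := -(1 / (1 - M.γ)))
    (B := 2 / (1 - M.γ)) (by positivity) (fun r => (hv r).1)
    (fun r => (hv r).2.trans (le_of_eq (by ring))) hn
    (fun i => hm2.comp (hX.measurable k i)) (fun i => hX.transition_law k i s a)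
    (hind.comp (fun _ y => (y s a).2) fun _ => hm2)
  have hW : ∀ ω, M.bellmanNoise (fun i => X k i ω) s a =
      (empDual (fun i => (X k i ω s a).1) (fun r => (r : ℝ)) M.δ - V) +
        M.γ * (empDual (fun i => (X k i ω s a).2) M.optValue M.δ - V') := fun ω =>
    M.bellmanNoise_eq _ s a (M.robustReturn_eq_add _ s a hV hV')
  simp only [hW]
  have hXm : Measurable fun ω i => X k i ω := measurable_pi_lambda _ (hX.measurable k)
  have hint : ∀ g : (Fin n → S → A → M.rewards × S) → ℝ, Integrable (fun ω => g fun i => X k i ω) P :=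
    fun g => integrable_comp_of_finite hXm g
  simp only [Function.comp_def] at hV2 hV1 hV2' hV1'
  have i1 : Integrable (fun ω => empDual (fun i => (X k i ω s a).1) (fun r => (r : ℝ)) M.δ - V) P :=
    hint fun x => empDual (fun i => (x i s a).1) (fun r => (r : ℝ)) M.δ - V
  have i2 : Integrable (fun ω => empDual (fun i => (X k i ω s a).2) M.optValue M.δ - V') P :=
    hint fun x => empDual (fun i => (x i s a).2) M.optValue M.δ - V'
  have j1 : Integrable
      (fun ω => (empDual (fun i => (X k i ω s a).1) (fun r => (r : ℝ)) M.δ - V) ^ 2) P :=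
    hint fun x => (empDual (fun i => (x i s a).1) (fun r => (r : ℝ)) M.δ - V) ^ 2
  have j2 : Integrable (fun ω => (empDual (fun i => (X k i ω s a).2) M.optValue M.δ - V') ^ 2) P :=
    hint fun x => (empDual (fun i => (x i s a).2) M.optValue M.δ - V') ^ 2
  have hκ1 : 1 - M.γ ≤ 1 := by linarith [M.γ_pos]
  have h1 : 1 ≤ 1 / (1 - M.γ) := by rwa [le_div_iff₀ hκ, one_mul]
  constructor
  · have hle := integral_mono (μ := P)
      (hint fun x => ((empDual (fun i => (x i s a).1) (fun r => (r : ℝ)) M.δ - V) +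
        M.γ * (empDual (fun i => (x i s a).2) M.optValue M.δ - V')) ^ 2)
      ((j1.const_mul 2).add (j2.const_mul 2)) fun ω => by
        simp only [Pi.add_apply]
        set y := empDual (fun i => (X k i ω s a).1) (fun r => (r : ℝ)) M.δ - V
        set z := empDual (fun i => (X k i ω s a).2) M.optValue M.δ - V'
        have h2 : (M.γ * z) ^ 2 ≤ z ^ 2 := by
          rw [mul_pow]
          exact mul_le_of_le_one_left (sq_nonneg z) (pow_le_one₀ M.γ_pos.le M.γ_lt_one.le)
        nlinarith [sq_nonneg (y - M.γ * z)]
    refine hle.trans ?_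
    have e := integral_add (j1.const_mul 2) (j2.const_mul 2)
    simp only [Pi.add_apply]
    rw [e, integral_const_mul, integral_const_mul]
    -- The second moment is at most `2 · 36 + 2 · 144 = 360 ≤ 400` in these units, the value
    -- function having span at most `2/(1 - γ)`.
    have h3 : (20 / (p * (1 - M.γ) * √n)) ^ 2 = 400 * (1 / (1 - M.γ)) ^ 2 / (n * p ^ 2) := by
      rw [div_pow, mul_pow, mul_pow, Real.sq_sqrt hn'.le]
      field_simp
      norm_num
    have h4 : 36 * (1 : ℝ) ^ 2 / (n * p ^ 2) ≤ 36 * (1 / (1 - M.γ)) ^ 2 / (n * p ^ 2) := by gcongr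
    have h5 : 36 * (2 / (1 - M.γ)) ^ 2 / (n * p ^ 2) =
        144 * ((1 / (1 - M.γ)) ^ 2 / (n * p ^ 2)) := by ring
    have h6 : 0 ≤ (1 / (1 - M.γ)) ^ 2 / (n * p ^ 2) := by positivity
    rw [h3]
    linarith [mul_div_assoc 36 ((1 / (1 - M.γ)) ^ 2) (n * p ^ 2),
      mul_div_assoc 400 ((1 / (1 - M.γ)) ^ 2) (n * p ^ 2)]
  · rw [integral_add i1 (i2.const_mul _), integral_const_mul]
    refine (abs_add_le _ _).trans ?_
    rw [abs_mul, abs_of_pos M.γ_pos]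
    have h2 : M.γ * |∫ ω, (empDual (fun i => (X k i ω s a).2) M.optValue M.δ - V') ∂P| ≤
        2718 * (2 / (1 - M.γ)) / (n * p ^ 3) :=
      (mul_le_of_le_one_left (abs_nonneg _) M.γ_lt_one.le).trans hV1'
    have h3 : 2718 * (1 : ℝ) / (n * p ^ 3) ≤ 2718 * (1 / (1 - M.γ)) / (n * p ^ 3) := by gcongr
    -- `8154 = 2718 · (1 + 2)`: the reward part and the transition part.
    have h4 : 8154 / (p ^ 3 * (1 - M.γ) * n) = 2718 * (1 / (1 - M.γ)) / (n * p ^ 3) +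
        2718 * (2 / (1 - M.γ)) / (n * p ^ 3) := by field_simp; norm_num
    linarith

/-- Concentration of the averaged noise of robust Q-learning. -/
theorem IsSampling.measureReal_stepAvg_le {M : RobustMDP S A}
    (hδ : M.δ ≤ M.minSupportProb / 32) (hR : ∀ r ∈ M.rewards, r ≤ 1) {n : ℕ} (hn : n ≠ 0)
    {Ω : Type w} [MeasurableSpace Ω] {P : Measure Ω} [IsProbabilityMeasure P]
    {X : ℕ → Fin n → Ω → S → A → M.rewards × S} (hX : M.IsSampling P X) (s : S) (a : A) (k : ℕ)
    {L : ℝ} (hL : 0 < L) :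
    P.real {ω | 8154 / (M.minSupportProb ^ 3 * (1 - M.γ) * n) +
      (2 * (20 / (M.minSupportProb * (1 - M.γ) * √n)) * √(M.stepsize k * L) +
        4 * (2 / (1 - M.γ)) * M.stepsize k * L) <
      |stepAvg M.stepsize (fun j => M.bellmanNoise (fun i => X j i ω) s a) k|} ≤
      2 * Real.exp (-L) := by
  have hp := M.minSupportProb_pos
  have hκ : 0 < 1 - M.γ := sub_pos.2 M.γ_lt_one
  have hn' : (0 : ℝ) < n := by exact_mod_cast Nat.pos_of_ne_zero hn
  have : MeasurableSingletonClass (S → A → M.rewards × S) := inferInstance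
  have : MeasurableSingletonClass (Fin n → S → A → M.rewards × S) :=
    Pi.instMeasurableSingletonClass
  have : DiscreteMeasurableSpace (Fin n → S → A → M.rewards × S) :=
    MeasurableSingletonClass.toDiscreteMeasurableSpace
  have hg : Measurable fun x : Fin n → S → A → M.rewards × S => M.bellmanNoise x s a :=
    Measurable.of_discrete
  exact _root_.measureReal_stepAvg_le
    (W := fun j ω => M.bellmanNoise (fun i => X j i ω) s a)
    (fun j => hg.comp (measurable_pi_lambda _ (hX.measurable j)))
    ((iIndepFun_blocks hX.measurable hX.indep).comp
      (fun _ x => M.bellmanNoise x s a) fun _ => hg)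
    (by positivity) (by positivity) (fun j ω => M.abs_bellmanNoise_le hR hn _ s a)
    (fun j => (hX.bellmanNoise_moments hδ hR hn s a j).2)
    (fun j => (hX.bellmanNoise_moments hδ hR hn s a j).1)
    M.stepsize_pos M.stepsize_le_one M.one_sub_stepsize_mul_le k hL

end Noise

end RobustMDP

/-! ### Summation of the error bounds over time. -/

section Sums

theorem sum_one_div_le (k : ℕ) :
    ∑ j ∈ Finset.range k, 1 / ((j : ℝ) + 1) ≤ 1 + Real.log k := by
  have h := harmonic_le_one_add_log k
  rw [harmonic] at h
  push_cast at h
  simpa only [one_div] using h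

theorem sum_one_div_sqrt_le (k : ℕ) : ∑ j ∈ Finset.range k, 1 / √((j : ℝ) + 1) ≤ 2 * √k := by
  induction k with
  | zero => simp
  | succ k ih =>
    rw [Finset.sum_range_succ]
    have h0 : 0 < √((k : ℝ) + 1) := Real.sqrt_pos.2 (by positivity)
    have h1 : √((k : ℝ) + 1) ^ 2 = k + 1 := Real.sq_sqrt (by positivity)
    have h2 : √(k : ℝ) ^ 2 = k := Real.sq_sqrt (by positivity)
    have h3 : 1 / √((k : ℝ) + 1) ≤ 2 * √((k : ℝ) + 1) - 2 * √k := by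
      rw [div_le_iff₀ h0]
      nlinarith [sq_nonneg (√((k : ℝ) + 1) - √k)]
    push_cast
    linarith

/-- Here `q, y, r, l` stand for the square roots of `1 - γ`, `n₀`, `k₀`, `L`, which makes everything
rational. The bias enters twice, once through the accumulated sum and once through the last average,
so `16308 = 2 · 8154`. The power `L²` comes from the harmonic sum times the `L` of Bernstein's
inequality. -/
theorem accumulated_error_arith {q p n y r l : ℝ} (hq : 0 < q) (hq1 : q ^ 2 ≤ 1) (hp : 0 < p)
    (hn : 0 < n) (hy : 0 < y) (hr : 0 < r) (hl : 1 ≤ l) :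
    1 / (q ^ 2 * r ^ 2) * (1 / q ^ 2 + (r ^ 2 * (8154 / (p ^ 3 * q ^ 2 * n)) +
      2 * (20 / (p * q ^ 2 * y)) * (l / q * (2 * r)) +
      4 * (2 / q ^ 2) * (1 / q ^ 2 * (1 + l ^ 2)) * l ^ 2)) +
    (8154 / (p ^ 3 * q ^ 2 * n) + 2 * (20 / (p * q ^ 2 * y)) * (l / q * (1 / r)) +
      4 * (2 / q ^ 2) * (1 / (q ^ 2 * r ^ 2)) * l ^ 2) ≤
    16308 * (1 / ((q ^ 2) ^ 3 * r ^ 2) + 1 / (p ^ 3 * (q ^ 2) ^ 2 * n) +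
      1 / (p * q ^ 5 * (y * r))) * (l ^ 2) ^ 2 := by
  have hA0 : 0 < 1 / ((q ^ 2) ^ 3 * r ^ 2) := by positivity
  have hB0 : 0 < 1 / (p ^ 3 * (q ^ 2) ^ 2 * n) := by positivity
  have hC0 : 0 < 1 / (p * q ^ 5 * (y * r)) := by positivity
  have e1 : 1 / (q ^ 2 * r ^ 2) * (1 / q ^ 2 + (r ^ 2 * (8154 / (p ^ 3 * q ^ 2 * n)) +
      2 * (20 / (p * q ^ 2 * y)) * (l / q * (2 * r)) +
      4 * (2 / q ^ 2) * (1 / q ^ 2 * (1 + l ^ 2)) * l ^ 2)) =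
      q ^ 2 * (1 / ((q ^ 2) ^ 3 * r ^ 2)) + 8154 * (1 / (p ^ 3 * (q ^ 2) ^ 2 * n)) +
        80 * l * (1 / (p * q ^ 5 * (y * r))) +
        8 * (1 / ((q ^ 2) ^ 3 * r ^ 2)) * ((1 + l ^ 2) * l ^ 2) := by
    field_simp
    ring
  have e2 : 8154 / (p ^ 3 * q ^ 2 * n) + 2 * (20 / (p * q ^ 2 * y)) * (l / q * (1 / r)) +
      4 * (2 / q ^ 2) * (1 / (q ^ 2 * r ^ 2)) * l ^ 2 =
      q ^ 2 * (8154 * (1 / (p ^ 3 * (q ^ 2) ^ 2 * n)) + 40 * l * (1 / (p * q ^ 5 * (y * r))) +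
        8 * (1 / ((q ^ 2) ^ 3 * r ^ 2)) * l ^ 2) := by
    field_simp
    ring
  rw [e1, e2]
  generalize 1 / ((q ^ 2) ^ 3 * r ^ 2) = A at *
  generalize 1 / (p ^ 3 * (q ^ 2) ^ 2 * n) = B at *
  generalize 1 / (p * q ^ 5 * (y * r)) = C at *
  have g1 : q ^ 2 * A ≤ A := mul_le_of_le_one_left hA0.le hq1
  have g2 : q ^ 2 * (8154 * B + 40 * l * C + 8 * A * l ^ 2) ≤
      8154 * B + 40 * l * C + 8 * A * l ^ 2 := mul_le_of_le_one_left (by positivity) hq1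
  have hl2 : 1 ≤ l ^ 2 := one_le_pow₀ hl
  have hl4 : l ^ 2 ≤ (l ^ 2) ^ 2 := by nlinarith
  have hl1 : l ≤ (l ^ 2) ^ 2 := by nlinarith
  have f1 : A * l ^ 2 ≤ A * (l ^ 2) ^ 2 := mul_le_mul_of_nonneg_left hl4 hA0.le
  have f2 : A * 1 ≤ A * (l ^ 2) ^ 2 := mul_le_mul_of_nonneg_left (by linarith) hA0.le
  have f3 : B * 1 ≤ B * (l ^ 2) ^ 2 := mul_le_mul_of_nonneg_left (by linarith) hB0.le
  have f4 : C * l ≤ C * (l ^ 2) ^ 2 := mul_le_mul_of_nonneg_left hl1 hC0.le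
  have f5 : 0 ≤ A * (l ^ 2) ^ 2 := by positivity
  have f6 : 0 ≤ C * (l ^ 2) ^ 2 := by positivity
  linarith

/-- The accumulated error bound, for step sizes `a j ≤ 1 / (κ (j + 1))`. -/
theorem accumulated_error_le {κ p : ℝ} (hκ : 0 < κ) (hκ1 : κ ≤ 1) (hp : 0 < p) {n k : ℕ}
    (hn : 1 ≤ n) (hk : 1 ≤ k) {a : ℕ → ℝ} (ha0 : ∀ j, 0 ≤ a j)
    (ha : ∀ j, a j ≤ 1 / (κ * (j + 1))) {L : ℝ} (hL1 : 1 ≤ L) (hLk : Real.log k ≤ L) {β : ℕ → ℝ}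
    (hβ : ∀ j, β j = 8154 / (p ^ 3 * κ * n) +
      (2 * (20 / (p * κ * √n)) * √(a j * L) + 4 * (2 / κ) * a j * L)) :
    a k * (1 / κ + ∑ j ∈ Finset.range k, β j) + β k ≤
      16308 * (1 / (κ ^ 3 * k) + 1 / (p ^ 3 * κ ^ 2 * n)
        + 1 / (p * κ ^ (5 / 2 : ℝ) * √((n : ℝ) * k))) * L ^ 2 := by
  have hn0 : (0 : ℝ) < n := by exact_mod_cast hn
  have hk0 : (0 : ℝ) < k := by exact_mod_cast hk
  have hL0 : 0 < L := by linarith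
  obtain ⟨q, hq, rfl⟩ : ∃ q : ℝ, 0 < q ∧ κ = q ^ 2 :=
    ⟨√κ, Real.sqrt_pos.2 hκ, (Real.sq_sqrt hκ.le).symm⟩
  have hpow : (q ^ 2) ^ (5 / 2 : ℝ) = q ^ 5 := by
    rw [← Real.rpow_natCast, ← Real.rpow_mul hq.le, ← Real.rpow_natCast]
    norm_num
  rw [hpow, Real.sqrt_mul hn0.le]
  set y := √(n : ℝ) with hy
  have hy0 : 0 < y := Real.sqrt_pos.2 hn0
  set r := √(k : ℝ) with hr
  have hr0 : 0 < r := Real.sqrt_pos.2 hk0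
  have hr2 : r ^ 2 = k := Real.sq_sqrt hk0.le
  set l := √L with hl
  have hl1 : 1 ≤ l := Real.one_le_sqrt.2 hL1
  have hl2 : l ^ 2 = L := Real.sq_sqrt hL0.le
  have hsqrt : ∀ j, √(a j * L) ≤ l / q * (1 / √((j : ℝ) + 1)) := fun j => by
    have hj : (0 : ℝ) < j + 1 := by positivity
    have h : a j * L ≤ (l / q * (1 / √((j : ℝ) + 1))) ^ 2 := by
      rw [mul_pow, div_pow, div_pow, one_pow, Real.sq_sqrt hj.le, hl2]
      calc a j * L ≤ 1 / (q ^ 2 * (j + 1)) * L := by gcongr; exact ha j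
        _ = _ := by field_simp
    exact Real.sqrt_le_iff.2 ⟨by positivity, h⟩
  set b := 8154 / (p ^ 3 * q ^ 2 * n) with hb
  set s := 20 / (p * q ^ 2 * y) with hs
  have hs0 : 0 < s := by positivity
  have hb0 : 0 < b := by positivity
  have hak : a k ≤ 1 / (q ^ 2 * k) := (ha k).trans (by gcongr; linarith)
  have hsum : ∑ j ∈ Finset.range k, β j ≤
      k * b + 2 * s * (l / q * (2 * r)) + 4 * (2 / q ^ 2) * (1 / q ^ 2 * (1 + L)) * L := by
    have h1 : ∑ j ∈ Finset.range k, √(a j * L) ≤ l / q * (2 * r) := by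
      refine (Finset.sum_le_sum fun j _ => hsqrt j).trans ?_
      rw [← Finset.mul_sum]
      gcongr
      exact sum_one_div_sqrt_le k
    have h2 : ∑ j ∈ Finset.range k, a j ≤ 1 / q ^ 2 * (1 + L) := by
      calc _ ≤ ∑ j ∈ Finset.range k, 1 / q ^ 2 * (1 / ((j : ℝ) + 1)) :=
            Finset.sum_le_sum fun j _ => (ha j).trans (le_of_eq (by field_simp))
        _ ≤ _ := by
            rw [← Finset.mul_sum]
            gcongr
            linarith [sum_one_div_le k]
    simp only [hβ, Finset.sum_add_distrib, Finset.sum_const, Finset.card_range, nsmul_eq_mul,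
      ← Finset.mul_sum, ← Finset.sum_mul]
    rw [← add_assoc]
    gcongr
  have hβk : β k ≤ b + 2 * s * (l / q * (1 / r)) + 4 * (2 / q ^ 2) * (1 / (q ^ 2 * k)) * L := by
    have h1 : √(a k * L) ≤ l / q * (1 / r) := (hsqrt k).trans (by
      gcongr
      rw [hr]
      exact Real.sqrt_le_sqrt (by linarith))
    rw [hβ, ← add_assoc]
    gcongr
  have hβ0 : 0 ≤ ∑ j ∈ Finset.range k, β j := Finset.sum_nonneg fun j _ => by
    have := ha0 j
    rw [hβ]
    positivity
  have hmain : a k * (1 / q ^ 2 + ∑ j ∈ Finset.range k, β j) ≤ 1 / (q ^ 2 * k) * (1 / q ^ 2 +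
      (k * b + 2 * s * (l / q * (2 * r)) + 4 * (2 / q ^ 2) * (1 / q ^ 2 * (1 + L)) * L)) := by
    gcongr
  refine (add_le_add hmain hβk).trans ?_
  rw [hb, hs, ← hl2, ← hr2]
  exact accumulated_error_arith hq hκ1 hp hn0 hy0 hr0 hl1

end Sums
-- Union bound and conclusion.
theorem mainTheorem5 :
    ∃ c : ℝ, 0 < c ∧
      ∀ (S : Type u) (A : Type v) [Fintype S] [Fintype A] [Nonempty S] [Nonempty A]
        [MeasurableSpace S] [DiscreteMeasurableSpace S] (M : RobustMDP S A)
        (_hδ : M.δ < -Real.log (1 - M.minSupportProb / 48))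
        (_hR : ∀ r ∈ M.rewards, r ≤ 1)
        (k₀ n₀ : ℕ) (_hk₀ : 1 ≤ k₀) (_hn₀ : 1 ≤ n₀)
        (Ω : Type w) [MeasurableSpace Ω] (P : Measure Ω) [IsProbabilityMeasure P]
        (X : ℕ → Fin n₀ → Ω → S → A → M.rewards × S) (_hX : M.IsSampling P X)
        (η : ℝ) (_hη : 0 < η) (_hη' : η < 1),
        1 - η ≤ P.real {ω | ‖M.drQ (fun k i => X k i ω) k₀ - M.optQ‖ ≤
          c * (1 / ((1 - M.γ) ^ 3 * k₀)
              + 1 / (M.minSupportProb ^ 3 * (1 - M.γ) ^ 2 * n₀)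
              + 1 / (M.minSupportProb * (1 - M.γ) ^ (5 / 2 : ℝ) * √((n₀ : ℝ) * k₀)))
            * Real.log (4 * M.size * k₀ / η) ^ 2} := by
  refine ⟨16308, by norm_num, ?_⟩
  intro S A _ _ _ _ _ _ M hδ hR k₀ n₀ hk₀ hn₀ Ω _ P _ X hX η hη hη'
  have hδ' := M.δ_le_of_lt_neg_log hδ
  have hn : n₀ ≠ 0 := by omega
  have hp := M.minSupportProb_pos
  have hκ : 0 < 1 - M.γ := sub_pos.2 M.γ_lt_one
  have hk : (1 : ℝ) ≤ k₀ := by exact_mod_cast hk₀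
  set N : ℝ := Fintype.card S * Fintype.card A with hN
  have hN1 : 1 ≤ N := by
    have h1 : 1 ≤ Fintype.card S * Fintype.card A := Nat.mul_pos Fintype.card_pos Fintype.card_pos
    rw [hN]
    exact_mod_cast h1
  have hsize : N ≤ M.size := by
    have h1 : Fintype.card S * Fintype.card A ≤ M.size :=
      Nat.le_mul_of_pos_right _ (lt_max_of_lt_left Fintype.card_pos)
    rw [hN]
    exact_mod_cast h1
  set E : ℝ := 4 * M.size * k₀ / η with hE
  have hEN : 4 * N * k₀ / η ≤ E := by rw [hE]; gcongr
  have hE4k : 4 * k₀ ≤ E := by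
    refine le_trans ?_ hEN
    rw [le_div_iff₀ hη]
    nlinarith [mul_le_mul_of_nonneg_right hN1 (show (0 : ℝ) ≤ k₀ by linarith)]
  have hE0 : 0 < E := by linarith
  set L := Real.log E with hL
  have hL1 : 1 ≤ L := by
    rw [hL, Real.le_log_iff_exp_le hE0]
    linarith [Real.exp_one_lt_d9]
  have hLk : Real.log k₀ ≤ L := Real.log_le_log (by linarith) (by linarith)
  set β : ℕ → ℝ := fun j => 8154 / (M.minSupportProb ^ 3 * (1 - M.γ) * n₀) +
      (2 * (20 / (M.minSupportProb * (1 - M.γ) * √n₀)) * √(M.stepsize j * L) +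
        4 * (2 / (1 - M.γ)) * M.stepsize j * L) with hβ
  have hfinal := accumulated_error_le hκ (by linarith [M.γ_pos]) hp hn₀ hk₀ (fun j => (M.stepsize_pos j).le) M.stepsize_le
    hL1 hLk (β := β) fun j => rfl
  -- Times `0, …, k₀ - 1` feed the recursion, and time `k₀` bounds the averaged noise in the output
  -- itself.
  set bad : Set Ω := ⋃ q ∈ (Finset.univ ×ˢ Finset.univ ×ˢ Finset.range (k₀ + 1) :
    Finset (S × A × ℕ)), {ω | β q.2.2 <
      |stepAvg M.stepsize (fun j => M.bellmanNoise (fun i => X j i ω) q.1 q.2.1) q.2.2|} with hbad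
  have hbadle : P.real bad ≤ η := by
    refine (measureReal_biUnion_finset_le _ _).trans ?_
    calc _ ≤ ∑ q ∈ (Finset.univ ×ˢ Finset.univ ×ˢ Finset.range (k₀ + 1) : Finset (S × A × ℕ)),
          2 * Real.exp (-L) := Finset.sum_le_sum fun q _ =>
            hX.measureReal_stepAvg_le hδ' hR hn q.1 q.2.1 q.2.2 (by linarith)
      _ = N * (k₀ + 1) * (2 * (1 / E)) := by
          rw [Finset.sum_const, Finset.card_product, Finset.card_product, Finset.card_univ,
            Finset.card_univ, Finset.card_range, nsmul_eq_mul, hL, Real.exp_neg, Real.exp_log hE0]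
          push_cast
          ring
      -- The `4` in the logarithm pays for the two tails and for `k₀ + 1 ≤ 2k₀`; only `|S||A| ≤ d`
      -- is needed.
      _ ≤ N * (2 * k₀) * (2 * (η / (4 * N * k₀))) := by
          have h1 : 1 / E ≤ η / (4 * N * k₀) := by
            rw [div_le_div_iff₀ hE0 (by positivity)]
            rw [div_le_iff₀ hη] at hEN
            linarith
          gcongr
          linarith
      _ = η := by field_simp; norm_num
  -- Covering the whole space by the good and bad events gives the lower bound by subadditivity,
  -- with no measurability to check.
  have hsub : Set.univ ⊆ {ω | ‖M.drQ (fun k i => X k i ω) k₀ - M.optQ‖ ≤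
      16308 * (1 / ((1 - M.γ) ^ 3 * k₀) + 1 / (M.minSupportProb ^ 3 * (1 - M.γ) ^ 2 * n₀)
        + 1 / (M.minSupportProb * (1 - M.γ) ^ (5 / 2 : ℝ) * √((n₀ : ℝ) * k₀))) * L ^ 2} ∪ bad := by
    intro ω _
    by_cases hω : ω ∈ bad
    · exact Or.inr hω
    left
    have hgood : ∀ j < k₀ + 1, ∀ s a,
        |stepAvg M.stepsize (fun j => M.bellmanNoise (fun i => X j i ω) s a) j| ≤ β j := by
      intro j hj s a
      by_contra h
      refine hω (Set.mem_biUnion (x := (s, a, j)) ?_ (not_le.1 h))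
      simpa using hj
    rw [Set.mem_ofPred_eq, pi_norm_le_iff_of_nonneg (by positivity)]
    intro s
    rw [pi_norm_le_iff_of_nonneg (by positivity)]
    intro a
    refine le_trans ?_ hfinal
    have h1 := M.abs_drQ_sub_le hR hn (fun k i => X k i ω) (fun j hj => hgood j (by omega)) s a
      (K := k₀)
    have h2 := hgood k₀ (by omega) s a
    have h3 := abs_add_le (M.drQ (fun k i => X k i ω) k₀ s a - M.optQ s a -
      stepAvg M.stepsize (fun j => M.bellmanNoise (fun i => X j i ω) s a) k₀)
      (stepAvg M.stepsize (fun j => M.bellmanNoise (fun i => X j i ω) s a) k₀)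
    rw [sub_add_cancel] at h3
    rw [Real.norm_eq_abs, Pi.sub_apply, Pi.sub_apply]
    linarith
  have h1 := measureReal_mono (μ := P) hsub
  have h2 := measureReal_union_le (μ := P) {ω | ‖M.drQ (fun k i => X k i ω) k₀ - M.optQ‖ ≤
      16308 * (1 / ((1 - M.γ) ^ 3 * k₀) + 1 / (M.minSupportProb ^ 3 * (1 - M.γ) ^ 2 * n₀)
        + 1 / (M.minSupportProb * (1 - M.γ) ^ (5 / 2 : ℝ) * √((n₀ : ℝ) * k₀))) * L ^ 2} bad
  rw [probReal_univ] at h1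
  linarith
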